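/- Let $n,m\ge 0$ be integers, let $\mathcal D\subseteq\mathbb R^m$ be compact and convex, and consider the system $$\dot x(t)=f(x(t),d(t)),\qquad f(x,d)=f_1(x)+f_2(x)\,d,\qquad x(0)=x_0,$$ where $f_1:\mathbb R^n\to\mathbb R^n$ and $f_2:\mathbb R^n\to\mathbb R^{n\times m}$ are such that $f$ is locally Lipschitz in $x$ uniformly over $d\in\mathcal D$: for every compact $\mathcal X\subseteq\mathbb R^n$ there is $L$ with $\|f(x,d)-f(y,d)\|\le L\|x-y\|$ for all $x,y\in\mathcal X$ and $d\in\mathcal D$. A disturbance is a measurable function $d:[0,\infty)\to\mathcal D$. A trajectory on $[0,a]$ from $x_0$ under $d$ is a continuous $x:[0,a]\to\mathbb R^n$ with $x(t)=x_0+\int_0^t f(x(s),d(s))\,ds$ for all $t\in[0,a]$. Let $h:\mathbb R^n\to\mathbb R$ be locally Lipschitz, let $\mathcal S\subseteq\mathbb R^n$ be open and bounded with $\mathcal S=\{x: h(x)<0\}$ and $\partial\mathcal S=\{x: h(x)=0\}$, let $\mathcal X_0\subseteq\mathcal S$ be compact, and let $0\le T<\infty$. The system is called safe on $[0,T]$ if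 for every $x_0\in\mathcal X_0$ and every disturbance $d$ the trajectory from $x_0$ under $d$ exists on $[0,T]$ and satisfies $x(t)\in\mathcal S$ for all $t\in[0,T]$. Then the system is safe on $[0,T]$ if and only if there is a continuously differentiable function $v:\overline{\mathcal S}\times[0,T]\to\mathbb R$ such that 1. $v(x,0)<0$ for all $x\in\mathcal X_0$; 2. $h(x)-v(x,t)\le 0$ for all $(x,t)\in\overline{\mathcal S}\times[0,T]$; 3. $\mathcal Lv(x,t)=\frac{\partial v}{\partial t}(x,t)+\frac{\partial v}{\partial x}(x,t)\,f(x,d)\le 0$ for all $(x,d,t)\in\overline{\mathcal S}\times\mathcal D\times[0,T]$. Here $v$ is continuously differentiable on $K=\overline{\mathcal S}\times[0,T]$ if there is a continuous $v'=(\partial v/\partial x,\partial v/\partial t)$ on $K$ with $v(q)=v(p)+v'(p)(q-p)+o(\|q-p\|)$ as $q\to p$ in $K$, for each $p\in K$; at points of $K$ where this does not determine $v'(p)$, condition 3 refers to such a continuous choice of $v'$. -/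

import Mathlib

open Set MeasureTheory

namespace FiniteTimeSafety

/-- The right-hand side `f(x, d) = f₁(x) + f₂(x) d`; the `n × m` matrix `f₂(x)` is given as a
linear map from `ℝᵐ` to `ℝⁿ`. -/
def field {n m : ℕ} (f₁ : EuclideanSpace ℝ (Fin n) → EuclideanSpace ℝ (Fin n))
    (f₂ : EuclideanSpace ℝ (Fin n) → (EuclideanSpace ℝ (Fin m) →L[ℝ] EuclideanSpace ℝ (Fin n)))
    (x : EuclideanSpace ℝ (Fin n)) (d : EuclideanSpace ℝ (Fin m)) : EuclideanSpace ℝ (Fin n) :=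
  f₁ x + f₂ x d

/-- `f` is locally Lipschitz in its first argument, uniformly over the second one in `D`:
on every compact set there is one Lipschitz constant for all `d ∈ D`. -/
def LipschitzOnCompactsUniformly {n m : ℕ}
    (f : EuclideanSpace ℝ (Fin n) → EuclideanSpace ℝ (Fin m) → EuclideanSpace ℝ (Fin n))
    (D : Set (EuclideanSpace ℝ (Fin m))) : Prop :=
  ∀ X : Set (EuclideanSpace ℝ (Fin n)), IsCompact X →
    ∃ L : ℝ, ∀ x ∈ X, ∀ y ∈ X, ∀ d ∈ D, ‖f x d - f y d‖ ≤ L * ‖x - y‖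

/-- Admissible disturbances: measurable, with values in `D` on `[0, ∞)`
(the values at negative times play no role). -/
def IsDisturbance {m : ℕ} (D : Set (EuclideanSpace ℝ (Fin m)))
    (d : ℝ → EuclideanSpace ℝ (Fin m)) : Prop :=
  Measurable d ∧ ∀ t, 0 ≤ t → d t ∈ D

/-- `x` is a (Carathéodory) solution on `[0, a]` of `x' = f(x, d(t))`, `x(0) = x₀`. -/
structure IsTrajectoryOn {n m : ℕ}
    (f : EuclideanSpace ℝ (Fin n) → EuclideanSpace ℝ (Fin m) → EuclideanSpace ℝ (Fin n))
    (d : ℝ → EuclideanSpace ℝ (Fin m)) (x₀ : EuclideanSpace ℝ (Fin n)) (a : ℝ)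
    (x : ℝ → EuclideanSpace ℝ (Fin n)) : Prop where
  continuousOn : ContinuousOn x (Icc 0 a)
  integrable : IntervalIntegrable (fun s => f (x s) (d s)) volume 0 a
  eq_integral : ∀ t ∈ Icc 0 a, x t = x₀ + ∫ s in (0 : ℝ)..t, f (x s) (d s)

/-- Safety over `[0, T]`: for every initial state in `X₀` and every disturbance the trajectory
is defined on all of `[0, T]` and stays in `S` there. -/
def IsSafe {n m : ℕ}
    (f : EuclideanSpace ℝ (Fin n) → EuclideanSpace ℝ (Fin m) → EuclideanSpace ℝ (Fin n))
    (D : Set (EuclideanSpace ℝ (Fin m))) (X₀ S : Set (EuclideanSpace ℝ (Fin n))) (T : ℝ) : Prop :=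
  ∀ x₀ ∈ X₀, ∀ d, IsDisturbance D d →
    (∃ x, IsTrajectoryOn f d x₀ T x) ∧
      ∀ x, IsTrajectoryOn f d x₀ T x → ∀ t ∈ Icc 0 T, x t ∈ S

/-- `v` is continuously differentiable on the set `K`, with derivative `v'`: the derivative is
taken within `K` (one-sided where `K` requires it) and is continuous on `K`.
At points of `K` where the derivative within `K` is not unique, `v'` is a continuous choice. -/
structure HasContDerivOn {n : ℕ} (v : EuclideanSpace ℝ (Fin n) × ℝ → ℝ)
    (v' : EuclideanSpace ℝ (Fin n) × ℝ → (EuclideanSpace ℝ (Fin n) × ℝ →L[ℝ] ℝ))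
    (K : Set (EuclideanSpace ℝ (Fin n) × ℝ)) : Prop where
  hasFDerivWithinAt : ∀ p ∈ K, HasFDerivWithinAt v (v' p) K p
  continuousOn : ContinuousOn v' K

/-- `ℒv(x, t) = ∂v/∂t (x, t) + ∂v/∂x (x, t) · f(x, d)`, for `v` with derivative `v'`. -/
def lieDeriv {n m : ℕ}
    (f : EuclideanSpace ℝ (Fin n) → EuclideanSpace ℝ (Fin m) → EuclideanSpace ℝ (Fin n))
    (v' : EuclideanSpace ℝ (Fin n) × ℝ → (EuclideanSpace ℝ (Fin n) × ℝ →L[ℝ] ℝ))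
    (x : EuclideanSpace ℝ (Fin n)) (t : ℝ) (d : EuclideanSpace ℝ (Fin m)) : ℝ :=
  v' (x, t) (0, 1) + v' (x, t) (f x d, 0)

end FiniteTimeSafety

/-! Sufficiency. While a trajectory stays in `closure S`, condition 3 keeps `v` from increasing
along it. At a first time `τ` outside `S` this gives `h (x τ) ≤ v (x τ, τ) ≤ v (x₀, 0) < 0`, which
puts `x τ` back in `S` (`IsTrajectoryOn.mem_of_barrier`).

Necessity. The natural barrier is the distance `u (x, t)` from `x` to the set of states reachable at
time `t`. Moving `x` and a reachable point with the same disturbance value separates them at rate at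
most `L`, so `exp (-L t) * u` does not increase along the field (`reachDist_add_le`). This function
is only Lipschitz. Mollifying at scale `η` costs `O(η)` both in value and in Lie derivative, and a
term linear in `t` absorbs the latter (`exists_contDiff_lieDeriv_le`). After scaling and lowering by
a constant the result dominates `h`, provided that reachable states satisfy `h ≤ -δ` for one `δ >
0`. That margin comes from compactness: limits of trajectories are trajectories because `D` is
compact and convex and `f` is affine in `d` (`exists_trajectory_of_tendsto`).

Only `closure S`, a bounded set, matters, so `f` is replaced throughout by a bounded, globally
Lipschitz field that agrees with it there. -/

namespace FiniteTimeSafety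

open Filter Topology

/-! ### Truncation to a bounded, globally Lipschitz field -/

/-- The vector field `F` is Lipschitz with constant `L` in the state and bounded by `M`, on the
whole space and uniformly over disturbance values in `D`. -/
structure IsBoundedLipschitzField {n m : ℕ}
    (F : EuclideanSpace ℝ (Fin n) → EuclideanSpace ℝ (Fin m) → EuclideanSpace ℝ (Fin n))
    (D : Set (EuclideanSpace ℝ (Fin m))) (L M : ℝ) : Prop where
  lipschitz_pos : 0 < L
  bound_nonneg : 0 ≤ M
  norm_sub_le : ∀ x y, ∀ d ∈ D, ‖F x d - F y d‖ ≤ L * ‖x - y‖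
  norm_le : ∀ x, ∀ d ∈ D, ‖F x d‖ ≤ M
  measurable_right : ∀ x, Measurable (F x)

variable {n m : ℕ}
  {F : EuclideanSpace ℝ (Fin n) → EuclideanSpace ℝ (Fin m) → EuclideanSpace ℝ (Fin n)}
  {D : Set (EuclideanSpace ℝ (Fin m))} {L M : ℝ}

theorem measurable_field (f₁ : EuclideanSpace ℝ (Fin n) → EuclideanSpace ℝ (Fin n))
    (f₂ : EuclideanSpace ℝ (Fin n) → (EuclideanSpace ℝ (Fin m) →L[ℝ] EuclideanSpace ℝ (Fin n)))
    (x : EuclideanSpace ℝ (Fin n)) : Measurable (field f₁ f₂ x) :=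
  ((f₂ x).continuous.const_add (f₁ x)).measurable

/-- The cutoff `max 0 (min 1 (r + 1 - ‖x‖))`. -/
theorem exists_lipschitz_cutoff (r : ℝ) :
    ∃ χ : EuclideanSpace ℝ (Fin n) → ℝ, (∀ x, 0 ≤ χ x) ∧ (∀ x, χ x ≤ 1) ∧
      (∀ x y, |χ x - χ y| ≤ ‖x - y‖) ∧ (∀ x, ‖x‖ ≤ r → χ x = 1) ∧
      (∀ x, r + 1 ≤ ‖x‖ → χ x = 0) := by
  refine ⟨fun x => max 0 (min 1 (r + 1 - ‖x‖)), fun x => le_max_left _ _,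
    fun x => max_le zero_le_one (min_le_left _ _), fun x y => ?_, fun x hx => ?_, fun x hx => ?_⟩
  · have h1 := abs_max_sub_max_le_abs (min 1 (r + 1 - ‖x‖)) (min 1 (r + 1 - ‖y‖)) 0
    have h2 := abs_inf_sub_inf_le_abs (r + 1 - ‖x‖) (r + 1 - ‖y‖) 1
    simp only
    rw [max_comm 0, max_comm 0]
    refine h1.trans ?_
    rw [min_comm 1, min_comm 1]
    refine h2.trans ?_
    rw [show r + 1 - ‖x‖ - (r + 1 - ‖y‖) = -(‖x‖ - ‖y‖) by ring, abs_neg]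
    exact abs_norm_sub_norm_le x y
  · simp only
    rw [min_eq_left (by linarith), max_eq_right zero_le_one]
  · simp only
    exact max_eq_left ((min_le_right _ _).trans (by linarith))

/-- Multiplying `f₁` and `f₂` by the same scalar cutoff keeps the field affine in `d`, which the
compactness argument needs later. -/
theorem exists_boundedLipschitz_truncation
    (f₁ : EuclideanSpace ℝ (Fin n) → EuclideanSpace ℝ (Fin n))
    (f₂ : EuclideanSpace ℝ (Fin n) → (EuclideanSpace ℝ (Fin m) →L[ℝ] EuclideanSpace ℝ (Fin n)))
    (hD : IsCompact D) (hf : LipschitzOnCompactsUniformly (field f₁ f₂) D) (r : ℝ) :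
    ∃ g₁ g₂ L M, IsBoundedLipschitzField (field (n := n) (m := m) g₁ g₂) D L M ∧
      ∀ x, ‖x‖ ≤ r → field g₁ g₂ x = field f₁ f₂ x := by
  obtain ⟨χ, h0, h1, hlip, hone, hzero⟩ := exists_lipschitz_cutoff (n := n) r
  obtain ⟨L, hL⟩ := hf (Metric.closedBall 0 (r + 1)) (isCompact_closedBall _ _)
  obtain ⟨C, hC⟩ := hD.isBounded.exists_norm_le
  have hbd : ∃ M : ℝ, 0 ≤ M ∧ ∀ x, ‖x‖ ≤ r + 1 → ∀ d ∈ D, ‖field f₁ f₂ x d‖ ≤ M := by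
    by_cases hr : 0 ≤ r + 1
    swap
    · exact ⟨0, le_rfl, fun x hx => absurd ((norm_nonneg x).trans hx) hr⟩
    -- Compare with the state `0`: the Lipschitz bound gives the first summand, the size of `field
    -- f₁ f₂ 0 d` on the bounded set `D` the second.
    refine ⟨max 0 (|L| * (r + 1) + (‖f₁ 0‖ + ‖f₂ 0‖ * C)), le_max_left _ _, fun x hx d hd => ?_⟩
    refine le_trans ?_ (le_max_right _ _)
    have e1 : ‖field f₁ f₂ x d - field f₁ f₂ 0 d‖ ≤ L * ‖x - 0‖ :=
      hL x (by simpa using hx) 0 (by simpa using hr) d hd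
    have e2 : ‖field f₁ f₂ 0 d‖ ≤ ‖f₁ 0‖ + ‖f₂ 0‖ * C := by
      refine (norm_add_le _ _).trans (add_le_add_right ?_ _)
      exact ((f₂ 0).le_opNorm d).trans (mul_le_mul_of_nonneg_left (hC d hd) (norm_nonneg _))
    have e3 : L * ‖x - 0‖ ≤ |L| * (r + 1) := by
      rw [sub_zero]
      exact mul_le_mul (le_abs_self L) hx (norm_nonneg _) (abs_nonneg _)
    have e4 := norm_add_le (field f₁ f₂ x d - field f₁ f₂ 0 d) (field f₁ f₂ 0 d)
    rw [sub_add_cancel] at e4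
    linarith
  obtain ⟨M, hM0, hM⟩ := hbd
  have hfield : ∀ x d, field (fun x => χ x • f₁ x) (fun x => χ x • f₂ x) x d
      = χ x • field f₁ f₂ x d := fun x d => by simp [field, smul_add]
  -- Product rule: `M` is the cutoff's slope times the bound on the field, `|L|` the field's own
  -- slope, and `1` makes the constant strictly positive. Only one of the two points has to lie in
  -- the ball, since the cutoff vanishes outside.
  have key : ∀ x y, ‖x‖ ≤ r + 1 → ∀ d ∈ D,
      ‖χ x • field f₁ f₂ x d - χ y • field f₁ f₂ y d‖ ≤ (M + |L| + 1) * ‖x - y‖ := by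
    intro x y hx d hd
    by_cases hy : ‖y‖ ≤ r + 1
    · have e1 : χ x • field f₁ f₂ x d - χ y • field f₁ f₂ y d
          = (χ x - χ y) • field f₁ f₂ x d + χ y • (field f₁ f₂ x d - field f₁ f₂ y d) := by
        rw [sub_smul, smul_sub]; abel
      rw [e1]
      refine (norm_add_le _ _).trans ?_
      rw [norm_smul, norm_smul, Real.norm_eq_abs, Real.norm_eq_abs, abs_of_nonneg (h0 y)]
      have e2 := mul_le_mul (hlip x y) (hM x hx d hd) (norm_nonneg _) (norm_nonneg _)
      have e3 := mul_le_mul (h1 y) (hL x (by simpa using hx) y (by simpa using hy) d hd)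
        (norm_nonneg _) zero_le_one
      have e4 := mul_le_mul_of_nonneg_right (le_abs_self L) (norm_nonneg (x - y))
      nlinarith [norm_nonneg (x - y)]
    · have hy0 := hzero y (le_of_not_ge hy)
      have e1 := hlip x y
      rw [hy0] at e1 ⊢
      rw [zero_smul, sub_zero, norm_smul, Real.norm_eq_abs]
      rw [sub_zero] at e1
      have e2 := mul_le_mul e1 (hM x hx d hd) (norm_nonneg _) (norm_nonneg _)
      nlinarith [norm_nonneg (x - y), abs_nonneg L, mul_nonneg (abs_nonneg L) (norm_nonneg (x - y))]
  refine ⟨fun x => χ x • f₁ x, fun x => χ x • f₂ x, M + |L| + 1, M,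
    ⟨by positivity, hM0, fun x y d hd => ?_, fun x d hd => ?_, measurable_field _ _⟩,
    fun x hx => ?_⟩
  · rw [hfield, hfield]
    by_cases hx : ‖x‖ ≤ r + 1
    · exact key x y hx d hd
    by_cases hy : ‖y‖ ≤ r + 1
    · rw [norm_sub_rev, norm_sub_rev x]
      exact key y x hy d hd
    rw [hzero x (le_of_not_ge hx), hzero y (le_of_not_ge hy)]
    simp only [zero_smul, sub_zero, norm_zero]
    positivity
  · rw [hfield]
    by_cases hx : ‖x‖ ≤ r + 1
    · rw [norm_smul, Real.norm_eq_abs, abs_of_nonneg (h0 x)]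
      exact (mul_le_of_le_one_left (norm_nonneg _) (h1 x)).trans (hM x hx d hd)
    · rw [hzero x (le_of_not_ge hx)]; simpa using hM0
  · funext d
    rw [hfield, hone x hx, one_smul]

namespace IsBoundedLipschitzField

theorem continuous_left (hF : IsBoundedLipschitzField F D L M) {d : EuclideanSpace ℝ (Fin m)}
    (hd : d ∈ D) : Continuous fun x => F x d := by
  refine (LipschitzWith.of_dist_le_mul (K := ⟨L, hF.lipschitz_pos.le⟩) fun x y => ?_).continuous
  rw [dist_eq_norm, dist_eq_norm]
  exact hF.norm_sub_le x y d hd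

theorem intervalIntegrable (hF : IsBoundedLipschitzField F D L M)
    {d : ℝ → EuclideanSpace ℝ (Fin m)} (hd : Measurable d) (hdD : ∀ t, d t ∈ D)
    {x : ℝ → EuclideanSpace ℝ (Fin n)} (hx : Measurable x) (a b : ℝ) :
    IntervalIntegrable (fun s => F (x s) (d s)) volume a b := by
  have h1 : Measurable (Function.uncurry fun (y : EuclideanSpace ℝ (Fin n)) (s : ℝ) => F y (d s)) :=
    measurable_uncurry_of_continuous_of_measurable (fun s => hF.continuous_left (hdD s))
      fun y => (hF.measurable_right y).comp hd
  have h2 : Measurable fun s => F (x s) (d s) := h1.comp (hx.prodMk measurable_id)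
  refine (intervalIntegrable_const (c := M)).mono_fun h2.aestronglyMeasurable ?_
  exact Eventually.of_forall fun s => (hF.norm_le _ _ (hdD s)).trans (le_abs_self M)

end IsBoundedLipschitzField

/-! ### Uniqueness and global existence of trajectories -/

theorem integral_exp_two_mul (L c τ : ℝ) :
    ∫ s in (0 : ℝ)..τ, L * c * Real.exp (2 * L * s) = c / 2 * (Real.exp (2 * L * τ) - 1) := by
  have h1 : ∀ s ∈ uIcc 0 τ, HasDerivAt (fun s => c / 2 * Real.exp (2 * L * s))
      (L * c * Real.exp (2 * L * s)) s := fun s _ => by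
    have := (((hasDerivAt_id s).const_mul (2 * L)).exp).const_mul (c / 2)
    refine this.congr_deriv ?_
    simp only [id]
    ring
  rw [intervalIntegral.integral_eq_sub_of_hasDerivAt h1
    (by apply Continuous.intervalIntegrable; fun_prop)]
  simp
  ring

/-- With the weight `exp (2 L s)`, twice the Lipschitz rate, integration gains a factor `1/2`. This
gain drives both uniqueness and the contraction for existence. -/
theorem norm_integral_le_half_exp {c τ : ℝ} (hc : 0 ≤ c) (hτ : 0 ≤ τ)
    {g : ℝ → EuclideanSpace ℝ (Fin n)}
    (hg : ∀ s ∈ Ioc 0 τ, ‖g s‖ ≤ L * c * Real.exp (2 * L * s)) :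
    ‖∫ s in (0 : ℝ)..τ, g s‖ ≤ c / 2 * Real.exp (2 * L * τ) := by
  refine (intervalIntegral.norm_integral_le_of_norm_le hτ (Eventually.of_forall hg)
    (by apply Continuous.intervalIntegrable; fun_prop)).trans ?_
  rw [integral_exp_two_mul]
  nlinarith

namespace IsTrajectoryOn

variable {d : ℝ → EuclideanSpace ℝ (Fin m)} {x₀ : EuclideanSpace ℝ (Fin n)} {a : ℝ}
  {x y : ℝ → EuclideanSpace ℝ (Fin n)}

theorem mono (hx : IsTrajectoryOn F d x₀ a x) {b : ℝ} (hb : 0 ≤ b) (hba : b ≤ a) :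
    IsTrajectoryOn F d x₀ b x where
  continuousOn := hx.continuousOn.mono (Icc_subset_Icc_right hba)
  integrable := hx.integrable.mono_set (by
    rw [uIcc_of_le hb, uIcc_of_le (hb.trans hba)]; exact Icc_subset_Icc_right hba)
  eq_integral t ht := hx.eq_integral t ⟨ht.1, ht.2.trans hba⟩

theorem intervalIntegrable (hx : IsTrajectoryOn F d x₀ a x) {s t : ℝ} (hs : s ∈ Icc 0 a)
    (ht : t ∈ Icc 0 a) : IntervalIntegrable (fun r => F (x r) (d r)) volume s t :=
  hx.integrable.mono_set ((uIcc_subset_Icc hs ht).trans Icc_subset_uIcc)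

theorem sub_eq_integral (hx : IsTrajectoryOn F d x₀ a x) {s t : ℝ} (hs : s ∈ Icc 0 a)
    (ht : t ∈ Icc 0 a) : x t - x s = ∫ r in s..t, F (x r) (d r) := by
  have h0 : (0 : ℝ) ∈ Icc 0 a := ⟨le_rfl, hs.1.trans hs.2⟩
  rw [hx.eq_integral t ht, hx.eq_integral s hs, add_sub_add_left_eq_sub,
    intervalIntegral.integral_interval_sub_left (hx.intervalIntegrable h0 ht)
      (hx.intervalIntegrable h0 hs)]

theorem apply_zero (hx : IsTrajectoryOn F d x₀ a x) (ha : 0 ≤ a) : x 0 = x₀ := by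
  simpa using hx.eq_integral 0 ⟨le_rfl, ha⟩

theorem congr_field {G : EuclideanSpace ℝ (Fin n) → EuclideanSpace ℝ (Fin m) →
    EuclideanSpace ℝ (Fin n)} (hx : IsTrajectoryOn F d x₀ a x) (ha : 0 ≤ a)
    (hFG : ∀ t ∈ Icc 0 a, F (x t) = G (x t)) : IsTrajectoryOn G d x₀ a x where
  continuousOn := hx.continuousOn
  integrable := hx.integrable.congr fun s hs => by
    rw [uIoc_of_le ha] at hs
    rw [hFG s (Ioc_subset_Icc_self hs)]
  eq_integral t ht := by
    rw [hx.eq_integral t ht]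
    congr 1
    refine intervalIntegral.integral_congr fun s hs => ?_
    rw [uIcc_of_le ht.1] at hs
    rw [hFG s ⟨hs.1, hs.2.trans ht.2⟩]

theorem norm_sub_le (hF : IsBoundedLipschitzField F D L M) (hd : IsDisturbance D d)
    (hx : IsTrajectoryOn F d x₀ a x) {s t : ℝ} (hs : s ∈ Icc 0 a) (ht : t ∈ Icc 0 a) :
    ‖x t - x s‖ ≤ M * |t - s| := by
  rw [hx.sub_eq_integral hs ht]
  refine intervalIntegral.norm_integral_le_of_norm_le_const fun r hr => ?_
  exact hF.norm_le _ _ (hd.2 r ((le_min hs.1 ht.1).trans hr.1.le))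

theorem eqOn (hF : IsBoundedLipschitzField F D L M) (hd : IsDisturbance D d)
    (hx : IsTrajectoryOn F d x₀ a x) (hy : IsTrajectoryOn F d x₀ a y) :
    EqOn x y (Icc 0 a) := by
  intro t ht
  have hL := hF.lipschitz_pos
  have hcont : ContinuousOn (fun s => Real.exp (-(2 * L * s)) * ‖x s - y s‖) (Icc 0 a) :=
    ContinuousOn.mul (by fun_prop) (hx.continuousOn.sub hy.continuousOn).norm
  -- In place of Gronwall: the maximum `c` of the weighted distance satisfies `c ≤ c / 2`, hence is
  -- `0`.
  obtain ⟨t₀, ht₀, hmax⟩ := isCompact_Icc.exists_isMaxOn ⟨t, ht⟩ hcont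
  set c := Real.exp (-(2 * L * t₀)) * ‖x t₀ - y t₀‖ with hc
  have hc0 : 0 ≤ c := by positivity
  have hle : ∀ s ∈ Icc 0 a, ‖x s - y s‖ ≤ c * Real.exp (2 * L * s) := fun s hs => by
    have h1 : Real.exp (-(2 * L * s)) * ‖x s - y s‖ ≤ c := hmax hs
    rw [Real.exp_neg, inv_mul_le_iff₀ (Real.exp_pos _)] at h1
    linarith
  have h0 : (0 : ℝ) ∈ Icc 0 a := ⟨le_rfl, ht.1.trans ht.2⟩
  have h2 : ‖x t₀ - y t₀‖ ≤ c / 2 * Real.exp (2 * L * t₀) := by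
    rw [hx.eq_integral t₀ ht₀, hy.eq_integral t₀ ht₀, add_sub_add_left_eq_sub,
      ← intervalIntegral.integral_sub (hx.intervalIntegrable h0 ht₀)
        (hy.intervalIntegrable h0 ht₀)]
    refine norm_integral_le_half_exp hc0 ht₀.1 fun s hs => ?_
    refine (hF.norm_sub_le _ _ _ (hd.2 s hs.1.le)).trans ?_
    rw [mul_assoc]
    exact mul_le_mul_of_nonneg_left (hle s ⟨hs.1.le, hs.2.trans ht₀.2⟩) hL.le
  have h3 : c ≤ c / 2 := by
    conv_lhs => rw [hc]
    rw [Real.exp_neg, inv_mul_le_iff₀ (Real.exp_pos _)]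
    linarith
  have h4 : c = 0 := by linarith
  have h5 := hle t ht
  rw [h4, zero_mul] at h5
  exact sub_eq_zero.1 (norm_le_zero_iff.1 h5)

end IsTrajectoryOn

theorem IsBoundedLipschitzField.exists_trajectory (hF : IsBoundedLipschitzField F D L M)
    {d : ℝ → EuclideanSpace ℝ (Fin m)} (hd : IsDisturbance D d) (x₀ : EuclideanSpace ℝ (Fin n)) :
    ∃ x, ∀ a, 0 ≤ a → IsTrajectoryOn F d x₀ a x := by
  have hL := hF.lipschitz_pos
  set d' : ℝ → EuclideanSpace ℝ (Fin m) := fun s => d (max s 0) with hd'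
  have hd'm : Measurable d' := hd.1.comp (measurable_id.max measurable_const)
  have hd'D : ∀ s, d' s ∈ D := fun s => hd.2 _ (le_max_right _ _)
  have hint : ∀ x : ℝ → EuclideanSpace ℝ (Fin n), Continuous x → ∀ a b,
      IntervalIntegrable (fun s => F (x s) (d' s)) volume a b :=
    fun x hx => hF.intervalIntegrable hd'm hd'D hx.measurable
  have hexp : ∀ y : BoundedContinuousFunction ℝ (EuclideanSpace ℝ (Fin n)),
      Continuous fun s => Real.exp (2 * L * s) • y s := fun y =>
    (by fun_prop : Continuous fun s : ℝ => Real.exp (2 * L * s)).smul y.continuous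
  -- Picard iteration in an exponentially weighted norm: the unknown is `y s = exp (-2 L s) • x s`,
  -- so a single contraction covers all of `[0, ∞)`. Negative times are frozen at `0` through `max`.
  set P : BoundedContinuousFunction ℝ (EuclideanSpace ℝ (Fin n)) → ℝ → EuclideanSpace ℝ (Fin n) :=
    fun y τ => x₀ + ∫ s in (0 : ℝ)..τ, F (Real.exp (2 * L * s) • y s) (d' s) with hP
  have hPc : ∀ y, Continuous (P y) := fun y =>
    continuous_const.add (intervalIntegral.continuous_primitive (hint _ (hexp y)) 0)
  have hPn : ∀ y τ, 0 ≤ τ → ‖P y τ‖ ≤ ‖x₀‖ + M * τ := fun y τ hτ => by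
    refine (norm_add_le _ _).trans (add_le_add_right ?_ _)
    have := intervalIntegral.norm_integral_le_of_norm_le_const (a := 0) (b := τ)
      (f := fun s => F (Real.exp (2 * L * s) • y s) (d' s)) fun s _ => hF.norm_le _ _ (hd'D s)
    rwa [sub_zero, abs_of_nonneg hτ] at this
  -- The bounded field makes `P y` grow at most linearly, so the weight makes it bounded.
  have hbound : ∀ y t, ‖Real.exp (-(2 * L * max t 0)) • P y (max t 0)‖ ≤ ‖x₀‖ + M / (2 * L) := by
    intro y t
    have ht : 0 ≤ max t 0 := le_max_right _ _
    set τ := max t 0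
    rw [norm_smul, Real.norm_eq_abs, abs_of_pos (Real.exp_pos _), Real.exp_neg,
      inv_mul_le_iff₀ (Real.exp_pos _)]
    refine (hPn y τ ht).trans ?_
    have h1 := Real.add_one_le_exp (2 * L * τ)
    have h2 : M * τ = M / (2 * L) * (2 * L * τ) := by field_simp
    have h3 : 0 ≤ M / (2 * L) := div_nonneg hF.bound_nonneg (by linarith)
    have h4 : 0 ≤ 2 * L * τ := by positivity
    rw [h2]
    nlinarith [norm_nonneg x₀]
  let Φ : BoundedContinuousFunction ℝ (EuclideanSpace ℝ (Fin n)) →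
      BoundedContinuousFunction ℝ (EuclideanSpace ℝ (Fin n)) := fun y =>
    BoundedContinuousFunction.ofNormedAddCommGroup
      (fun t => Real.exp (-(2 * L * max t 0)) • P y (max t 0))
      ((by fun_prop : Continuous fun t : ℝ => Real.exp (-(2 * L * max t 0))).smul ((hPc y).comp (continuous_id.max continuous_const)))
      _ (hbound y)
  have hΦ : ∀ y t, Φ y t = Real.exp (-(2 * L * max t 0)) • P y (max t 0) := fun _ _ => rfl
  have hcontr : ContractingWith (1 / 2) Φ := by
    refine ⟨by rw [← NNReal.coe_lt_coe]; norm_num, LipschitzWith.of_dist_le_mul fun y z => ?_⟩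
    refine (BoundedContinuousFunction.dist_le (by positivity)).2 fun t => ?_
    rw [hΦ, hΦ, dist_eq_norm, ← smul_sub, norm_smul, Real.norm_eq_abs, abs_of_pos (Real.exp_pos _),
      Real.exp_neg, inv_mul_le_iff₀ (Real.exp_pos _), hP]
    simp only
    rw [add_sub_add_left_eq_sub,
      ← intervalIntegral.integral_sub (hint _ (hexp y) _ _) (hint _ (hexp z) _ _)]
    refine (norm_integral_le_half_exp (L := L) (c := dist y z) dist_nonneg (le_max_right _ _)
      fun s hs => ?_).trans (le_of_eq ?_)
    · refine (hF.norm_sub_le _ _ _ (hd'D s)).trans ?_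
      rw [← smul_sub, norm_smul, Real.norm_eq_abs, abs_of_pos (Real.exp_pos _), ← dist_eq_norm]
      have := y.dist_coe_le_dist (g := z) s
      have h2 := mul_le_mul_of_nonneg_left this (Real.exp_pos (2 * L * s)).le
      nlinarith
    · push_cast; ring
  obtain ⟨y, hy⟩ : ∃ y, Φ y = y := ⟨_, hcontr.fixedPoint_isFixedPt⟩
  refine ⟨fun s => Real.exp (2 * L * s) • y s, fun a ha => ⟨(hexp y).continuousOn, ?_, ?_⟩⟩
  · refine (hint _ (hexp y) 0 a).congr fun s hs => ?_
    rw [uIoc_of_le ha] at hs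
    simp only [hd']
    rw [max_eq_left hs.1.le]
  · intro t ht
    have h1 : y t = Real.exp (-(2 * L * t)) • P y t := by
      conv_lhs => rw [← hy]
      rw [hΦ, max_eq_left ht.1]
    rw [h1, smul_smul, ← Real.exp_add, add_neg_cancel, Real.exp_zero, one_smul]
    refine congrArg (x₀ + ·) (intervalIntegral.integral_congr fun s hs => ?_)
    rw [uIcc_of_le ht.1] at hs
    simp only [hd']
    rw [max_eq_left hs.1]

end FiniteTimeSafety

/-! ### Reachable sets and the distance to them -/

namespace FiniteTimeSafety

open Filter Topology

variable {n m : ℕ}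
  {F : EuclideanSpace ℝ (Fin n) → EuclideanSpace ℝ (Fin m) → EuclideanSpace ℝ (Fin n)}
  {D : Set (EuclideanSpace ℝ (Fin m))} {L M : ℝ}

theorem IsTrajectoryOn.congr_disturbance {d d' : ℝ → EuclideanSpace ℝ (Fin m)}
    {x₀ : EuclideanSpace ℝ (Fin n)} {a : ℝ} {x : ℝ → EuclideanSpace ℝ (Fin n)}
    (hx : IsTrajectoryOn F d x₀ a x) (ha : 0 ≤ a) (hdd' : EqOn d d' (Icc 0 a)) :
    IsTrajectoryOn F d' x₀ a x where
  continuousOn := hx.continuousOn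
  integrable := hx.integrable.congr fun s hs => by
    rw [uIoc_of_le ha] at hs
    rw [hdd' (Ioc_subset_Icc_self hs)]
  eq_integral t ht := by
    rw [hx.eq_integral t ht]
    congr 1
    refine intervalIntegral.integral_congr fun s hs => ?_
    rw [uIcc_of_le ht.1] at hs
    rw [hdd' ⟨hs.1, hs.2.trans ht.2⟩]

/-- States reached at time `t` by trajectories starting in `X₀` and defined for all times. -/
def reachSet (F : EuclideanSpace ℝ (Fin n) → EuclideanSpace ℝ (Fin m) → EuclideanSpace ℝ (Fin n))
    (D : Set (EuclideanSpace ℝ (Fin m))) (X₀ : Set (EuclideanSpace ℝ (Fin n))) (t : ℝ) :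
    Set (EuclideanSpace ℝ (Fin n)) :=
  {p | ∃ x₀ ∈ X₀, ∃ d, IsDisturbance D d ∧ ∃ x, (∀ a, 0 ≤ a → IsTrajectoryOn F d x₀ a x) ∧ x t = p}

variable {X₀ : Set (EuclideanSpace ℝ (Fin n))}

theorem isDisturbance_const {e : EuclideanSpace ℝ (Fin m)} (he : e ∈ D) :
    IsDisturbance D fun _ => e :=
  ⟨measurable_const, fun _ _ => he⟩

theorem reachSet_nonempty (hF : IsBoundedLipschitzField F D L M) (hD : D.Nonempty)
    (hX₀ : X₀.Nonempty) (t : ℝ) : (reachSet F D X₀ t).Nonempty := by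
  obtain ⟨e, he⟩ := hD
  obtain ⟨x₀, hx₀⟩ := hX₀
  obtain ⟨x, hx⟩ := hF.exists_trajectory (isDisturbance_const he) x₀
  exact ⟨x t, x₀, hx₀, _, isDisturbance_const he, x, hx, rfl⟩

theorem subset_reachSet_zero (hF : IsBoundedLipschitzField F D L M) (hD : D.Nonempty) :
    X₀ ⊆ reachSet F D X₀ 0 := by
  intro x₀ hx₀
  obtain ⟨e, he⟩ := hD
  obtain ⟨x, hx⟩ := hF.exists_trajectory (isDisturbance_const he) x₀
  exact ⟨x₀, hx₀, _, isDisturbance_const he, x, hx, (hx 0 le_rfl).apply_zero le_rfl⟩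

/-- From a reachable state, a constant disturbance leads to a reachable state whose displacement is
given by the vector field up to second order. -/
theorem exists_reachSet_add (hF : IsBoundedLipschitzField F D L M)
    {e : EuclideanSpace ℝ (Fin m)} (he : e ∈ D) {s r : ℝ} (hs : 0 ≤ s) (hr : 0 ≤ r)
    {p : EuclideanSpace ℝ (Fin n)} (hp : p ∈ reachSet F D X₀ s) :
    ∃ q ∈ reachSet F D X₀ (s + r), ‖q - p - r • F p e‖ ≤ L * M * r ^ 2 ∧ ‖q - p‖ ≤ M * r := by
  obtain ⟨x₀, hx₀, d, hd, y, hy, rfl⟩ := hp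
  -- Follow `d` up to time `s`, then hold `e`. By uniqueness the new trajectory still passes through
  -- the given state at time `s`.
  set d' : ℝ → EuclideanSpace ℝ (Fin m) := fun t => if t ≤ s then d t else e with hd'
  have hd'D : IsDisturbance D d' := by
    refine ⟨Measurable.ite measurableSet_Iic hd.1 measurable_const, fun t ht => ?_⟩
    simp only [hd']
    split_ifs
    · exact hd.2 t ht
    · exact he
  obtain ⟨x, hx⟩ := hF.exists_trajectory hd'D x₀
  have hyx : y s = x s := by
    refine ((hy s hs).congr_disturbance hs fun t ht => ?_).eqOn hF hd'D (hx s hs) ⟨hs, le_rfl⟩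
    simp only [hd']
    rw [if_pos ht.2]
  have hsr : 0 ≤ s + r := add_nonneg hs hr
  have hs' : s ∈ Icc 0 (s + r) := ⟨hs, by linarith⟩
  have hsr' : s + r ∈ Icc 0 (s + r) := ⟨hsr, le_rfl⟩
  have hmove : ∀ t ∈ Icc s (s + r), ‖x t - x s‖ ≤ M * (t - s) := fun t ht => by
    have := (hx _ hsr).norm_sub_le hF hd'D hs' ⟨hs.trans ht.1, ht.2⟩
    rwa [abs_of_nonneg (sub_nonneg.2 ht.1)] at this
  refine ⟨x (s + r), ⟨x₀, hx₀, d', hd'D, x, hx, rfl⟩, ?_, ?_⟩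
  · have h1 : r • F (y s) e = ∫ _ in s..(s + r), F (y s) e := by
      rw [intervalIntegral.integral_const, add_sub_cancel_left]
    rw [h1, hyx, (hx _ hsr).sub_eq_integral hs' hsr', ← intervalIntegral.integral_sub
      ((hx _ hsr).intervalIntegrable hs' hsr') intervalIntegrable_const]
    have h2 := intervalIntegral.norm_integral_le_of_norm_le_const (a := s) (b := s + r)
      (f := fun t => F (x t) (d' t) - F (x s) e) (C := L * (M * r)) fun t ht => by
        rw [uIoc_of_le (by linarith)] at ht
        simp only [hd']
        rw [if_neg (not_le.2 ht.1)]
        refine (hF.norm_sub_le _ _ _ he).trans (mul_le_mul_of_nonneg_left ?_ hF.lipschitz_pos.le)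
        exact (hmove t (Ioc_subset_Icc_self ht)).trans
          (mul_le_mul_of_nonneg_left (by linarith [ht.2]) hF.bound_nonneg)
    rw [add_sub_cancel_left, abs_of_nonneg hr] at h2
    linarith
  · have := hmove (s + r) ⟨by linarith, le_rfl⟩
    rwa [add_sub_cancel_left, ← hyx] at this

theorem exists_reachSet_of_le (hF : IsBoundedLipschitzField F D L M) {s t : ℝ} (hs : 0 ≤ s)
    (hst : s ≤ t) {q : EuclideanSpace ℝ (Fin n)} (hq : q ∈ reachSet F D X₀ t) :
    ∃ p ∈ reachSet F D X₀ s, ‖q - p‖ ≤ M * (t - s) := by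
  obtain ⟨x₀, hx₀, d, hd, x, hx, rfl⟩ := hq
  refine ⟨x s, ⟨x₀, hx₀, d, hd, x, hx, rfl⟩, ?_⟩
  have := (hx t (hs.trans hst)).norm_sub_le hF hd ⟨hs, hst⟩ ⟨hs.trans hst, le_rfl⟩
  rwa [abs_of_nonneg (sub_nonneg.2 hst)] at this

theorem infDist_le_infDist_add {A B : Set (EuclideanSpace ℝ (Fin n))} {c : ℝ} (hA : A.Nonempty)
    (hAB : ∀ p ∈ A, ∃ q ∈ B, ‖q - p‖ ≤ c) (x : EuclideanSpace ℝ (Fin n)) :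
    Metric.infDist x B ≤ Metric.infDist x A + c := by
  rw [← sub_le_iff_le_add, Metric.le_infDist hA]
  intro p hp
  obtain ⟨q, hq, hqp⟩ := hAB p hp
  have h1 := Metric.infDist_le_dist_of_mem (x := x) hq
  have h2 := dist_triangle x p q
  rw [dist_comm p q, dist_eq_norm q p] at h2
  linarith

/-- Distance to the reachable set, frozen at its initial value for negative times. -/
noncomputable def reachDist
    (F : EuclideanSpace ℝ (Fin n) → EuclideanSpace ℝ (Fin m) → EuclideanSpace ℝ (Fin n))
    (D : Set (EuclideanSpace ℝ (Fin m))) (X₀ : Set (EuclideanSpace ℝ (Fin n)))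
    (p : EuclideanSpace ℝ (Fin n) × ℝ) : ℝ :=
  Metric.infDist p.1 (reachSet F D X₀ (max p.2 0))

/-- Reachable sets at times `s` and `t` are within `M * |t - s|` of each other: backwards along the
trajectory itself, forwards by holding a constant disturbance. The distance thus has slope `1` in
space and `M` in time. -/
theorem abs_reachDist_sub_le (hF : IsBoundedLipschitzField F D L M) (hD : D.Nonempty)
    (hX₀ : X₀.Nonempty) (p q : EuclideanSpace ℝ (Fin n) × ℝ) :
    |reachDist F D X₀ p - reachDist F D X₀ q| ≤ (1 + M) * ‖p - q‖ := by
  have hne := reachSet_nonempty hF hD hX₀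
  have htime : ∀ (x : EuclideanSpace ℝ (Fin n)) (s t : ℝ), 0 ≤ s → 0 ≤ t →
      Metric.infDist x (reachSet F D X₀ s) ≤ Metric.infDist x (reachSet F D X₀ t) + M * |t - s| := by
    intro x s t hs ht
    refine infDist_le_infDist_add (hne t) (fun p hp => ?_) x
    rcases le_total s t with hst | hst
    · obtain ⟨q, hq, hqp⟩ := exists_reachSet_of_le hF hs hst hp
      exact ⟨q, hq, by rwa [norm_sub_rev, abs_of_nonneg (sub_nonneg.2 hst)]⟩
    · obtain ⟨e, he⟩ := hD
      obtain ⟨q, hq, -, hqp⟩ := exists_reachSet_add hF he ht (sub_nonneg.2 hst) hp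
      rw [add_sub_cancel] at hq
      exact ⟨q, hq, by rwa [abs_sub_comm, abs_of_nonneg (sub_nonneg.2 hst)]⟩
  have key : ∀ p q : EuclideanSpace ℝ (Fin n) × ℝ,
      reachDist F D X₀ p - reachDist F D X₀ q ≤ (1 + M) * ‖p - q‖ := by
    intro p q
    have h1 : Metric.infDist p.1 (reachSet F D X₀ (max p.2 0)) ≤ _ :=
      Metric.infDist_le_infDist_add_dist (y := q.1)
    have h2 := htime q.1 (max p.2 0) (max q.2 0) (le_max_right _ _) (le_max_right _ _)
    have h3 := abs_max_sub_max_le_abs q.2 p.2 0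
    have h4 : |q.2 - p.2| ≤ ‖p - q‖ := by rw [abs_sub_comm]; exact norm_snd_le (p - q)
    have h5 : dist p.1 q.1 ≤ ‖p - q‖ := by rw [dist_eq_norm]; exact norm_fst_le (p - q)
    have h6 := mul_le_mul_of_nonneg_left (h3.trans h4) hF.bound_nonneg
    simp only [reachDist]
    linarith
  rw [abs_sub_le_iff]
  exact ⟨key p q, by rw [norm_sub_rev]; exact key q p⟩

/-- Along the vector field the distance to the reachable set grows at most at rate `L`. -/
theorem reachDist_add_le (hF : IsBoundedLipschitzField F D L M) (hD : D.Nonempty)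
    (hX₀ : X₀.Nonempty) {e : EuclideanSpace ℝ (Fin m)} (he : e ∈ D)
    (x : EuclideanSpace ℝ (Fin n)) {t s : ℝ} (ht : 0 ≤ t) (hs : 0 ≤ s) :
    reachDist F D X₀ (x + s • F x e, t + s)
      ≤ (1 + L * s) * reachDist F D X₀ (x, t) + L * M * s ^ 2 := by
  simp only [reachDist]
  rw [max_eq_left ht, max_eq_left (add_nonneg ht hs)]
  have hpos : 0 < 1 + L * s := by have := mul_nonneg hF.lipschitz_pos.le hs; linarith
  -- A nearest reachable point need not exist, so the inequality is rearranged into a lower bound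
  -- for the infimum and checked at each reachable `p`.
  rw [← sub_le_iff_le_add, ← div_le_iff₀' hpos,
    Metric.le_infDist (reachSet_nonempty hF hD hX₀ t)]
  intro p hp
  rw [div_le_iff₀' hpos, sub_le_iff_le_add]
  obtain ⟨q, hq, hqp, -⟩ := exists_reachSet_add hF he ht hs hp
  refine (Metric.infDist_le_dist_of_mem hq).trans ?_
  have h1 : x + s • F x e - q = (x - p) + s • (F x e - F p e) - (q - p - s • F p e) := by
    rw [smul_sub]; abel
  rw [dist_eq_norm, dist_eq_norm, h1]
  refine (norm_sub_le _ _).trans (add_le_add ((norm_add_le _ _).trans ?_) hqp)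
  rw [norm_smul, Real.norm_eq_abs, abs_of_nonneg hs]
  have := mul_le_mul_of_nonneg_left (hF.norm_sub_le x p e he) hs
  linarith

end FiniteTimeSafety

/-! ### A barrier function forces safety -/

namespace FiniteTimeSafety

open Filter Topology

variable {n m : ℕ}
  {F : EuclideanSpace ℝ (Fin n) → EuclideanSpace ℝ (Fin m) → EuclideanSpace ℝ (Fin n)}
  {D : Set (EuclideanSpace ℝ (Fin m))} {L M : ℝ}

/-- A function with nonpositive Lie derivative on `C` does not increase along trajectories that
stay in `C`. -/
theorem IsTrajectoryOn.apply_le_apply_zero (hF : IsBoundedLipschitzField F D L M)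
    {d : ℝ → EuclideanSpace ℝ (Fin m)} (hd : IsDisturbance D d)
    {x₀ : EuclideanSpace ℝ (Fin n)} {a T : ℝ} {x : ℝ → EuclideanSpace ℝ (Fin n)}
    (hx : IsTrajectoryOn F d x₀ a x) (haT : a ≤ T) {C : Set (EuclideanSpace ℝ (Fin n))}
    (hxC : ∀ t ∈ Icc 0 a, x t ∈ C) {v : EuclideanSpace ℝ (Fin n) × ℝ → ℝ}
    {v' : EuclideanSpace ℝ (Fin n) × ℝ → (EuclideanSpace ℝ (Fin n) × ℝ →L[ℝ] ℝ)}
    (hv : ∀ p ∈ C ×ˢ Icc 0 T, HasFDerivWithinAt v (v' p) (C ×ˢ Icc 0 T) p)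
    (hLie : ∀ x ∈ C, ∀ d ∈ D, ∀ t ∈ Icc 0 T, lieDeriv F v' x t d ≤ 0)
    {t : ℝ} (ht : t ∈ Icc 0 a) : v (x t, t) ≤ v (x₀, 0) := by
  have ha : 0 ≤ a := ht.1.trans ht.2
  have hmem : ∀ s ∈ Icc 0 a, (x s, s) ∈ C ×ˢ Icc 0 T := fun s hs =>
    ⟨hxC s hs, hs.1, hs.2.trans haT⟩
  have hgraph : ContinuousOn (fun s => (x s, s)) (Icc 0 a) := hx.continuousOn.prodMk continuousOn_id
  have hcont : ContinuousOn (fun s => v (x s, s)) (Icc 0 a) :=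
    ContinuousOn.comp (t := C ×ˢ Icc 0 T) (fun p hp => (hv p hp).continuousWithinAt) hgraph hmem
  -- This comparison principle needs only right-hand slopes, so `x` need not be differentiable at
  -- any given time.
  refine image_le_of_liminf_slope_right_le_deriv_boundary (f := fun s => v (x s, s))
    (B := fun _ => v (x₀, 0)) (B' := fun _ => 0) hcont ?_ continuousOn_const
    (fun s _ => hasDerivWithinAt_const _ _ _) ?_ ht
  · rw [hx.apply_zero ha]
  intro s hs r hr
  refine Eventually.frequently ?_
  have hs' : s ∈ Icc 0 a := Ico_subset_Icc_self hs
  set ℓ := v' (x s, s) with hℓ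
  have hM1 : 0 < M + 1 := by linarith [hF.bound_nonneg]
  -- The graph moves by at most `(M + 1) * (z - s)`, so the differentiability remainder contributes
  -- at most `r / 2` to the slope; `hsmall` leaves the other half for the linear part.
  have hc : 0 < r / (2 * (M + 1)) := by positivity
  have hnear : Ioc s a ∈ 𝓝[>] s := Ioc_mem_nhdsGT hs.2
  have htend : Tendsto (fun z => (x z, z)) (𝓝[>] s) (𝓝[C ×ˢ Icc 0 T] (x s, s)) := by
    refine tendsto_nhdsWithin_iff.2 ⟨?_, ?_⟩
    · exact (hgraph s hs').mono_left (nhdsWithin_le_iff.2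
        (mem_of_superset hnear fun z hz => ⟨hs.1.trans hz.1.le, hz.2⟩))
    · filter_upwards [hnear] with z hz using hmem z ⟨hs.1.trans hz.1.le, hz.2⟩
  have hlittle := htend.eventually ((hv _ (hmem s hs')).isLittleO.def hc)
  have hsmall : ∀ᶠ z in 𝓝[>] s, ‖ℓ‖ * (L * M) * (z - s) < r / 2 := by
    have : Tendsto (fun z => ‖ℓ‖ * (L * M) * (z - s)) (𝓝 s) (𝓝 (‖ℓ‖ * (L * M) * (s - s))) :=
      (by fun_prop : Continuous fun z => ‖ℓ‖ * (L * M) * (z - s)).tendsto s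
    rw [sub_self, mul_zero] at this
    exact (this.mono_left nhdsWithin_le_nhds).eventually (gt_mem_nhds (by positivity))
  filter_upwards [hlittle, hsmall, hnear] with z hz1 hz2 hz
  have hzs : 0 < z - s := sub_pos.2 hz.1
  have hz' : z ∈ Icc 0 a := ⟨hs.1.trans hz.1.le, hz.2⟩
  have hmove : ∀ ρ ∈ Icc s z, ‖x ρ - x s‖ ≤ M * (ρ - s) := fun ρ hρ => by
    have := hx.norm_sub_le hF hd hs' (t := ρ) ⟨hs.1.trans hρ.1, hρ.2.trans hz.2⟩
    rwa [abs_of_nonneg (sub_nonneg.2 hρ.1)] at this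
  have hlin : ℓ (x z - x s, z - s) ≤ ‖ℓ‖ * (L * M) * (z - s) * (z - s) := by
    set ℓ₁ : EuclideanSpace ℝ (Fin n) →L[ℝ] ℝ :=
      ℓ.comp (ContinuousLinearMap.inl ℝ (EuclideanSpace ℝ (Fin n)) ℝ) with hℓ₁
    have hℓ₁a : ∀ w, ℓ₁ w = ℓ (w, 0) := fun w => rfl
    have hsplit : ℓ (x z - x s, z - s) = ℓ₁ (x z - x s) + (z - s) * ℓ (0, 1) := by
      rw [hℓ₁a, ← smul_eq_mul, ← map_smul, ← map_add]
      simp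
    have hint := hx.intervalIntegrable hs' hz'
    -- Under the integral the state is frozen at `x s` while the disturbance keeps its value `d ρ`;
    -- condition 3 at `(x s, d ρ, s)` then applies for every `ρ`.
    have hbd : ℓ₁ (x z - x s) ≤ ∫ _ in s..z, (‖ℓ‖ * (L * M) * (z - s) - ℓ (0, 1)) := by
      rw [hx.sub_eq_integral hs' hz', ← ℓ₁.intervalIntegral_comp_comm hint]
      refine intervalIntegral.integral_mono_on hz.1.le
        ⟨ℓ₁.integrable_comp hint.1, ℓ₁.integrable_comp hint.2⟩ intervalIntegrable_const
        fun ρ hρ => ?_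
      have hdρ := hd.2 ρ (hs.1.trans hρ.1)
      have h1 := hLie (x s) (hxC s hs') (d ρ) hdρ s ⟨hs.1, hs'.2.trans haT⟩
      simp only [lieDeriv, ← hℓ, ← hℓ₁a] at h1
      have h2 : ℓ₁ (F (x ρ) (d ρ)) - ℓ₁ (F (x s) (d ρ)) ≤ ‖ℓ‖ * (L * M) * (z - s) := by
        rw [← map_sub, hℓ₁a]
        refine (le_abs_self _).trans ((ℓ.le_opNorm _).trans ?_)
        rw [mul_assoc, mul_assoc]
        refine mul_le_mul_of_nonneg_left ?_ (norm_nonneg _)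
        rw [Prod.norm_mk, norm_zero, max_eq_left (norm_nonneg _)]
        refine (hF.norm_sub_le _ _ _ hdρ).trans
          (mul_le_mul_of_nonneg_left ?_ hF.lipschitz_pos.le)
        exact (hmove ρ hρ).trans
          (mul_le_mul_of_nonneg_left (by linarith [hρ.2]) hF.bound_nonneg)
      linarith
    rw [intervalIntegral.integral_const, smul_eq_mul] at hbd
    rw [hsplit]
    linarith
  have hdisp : ‖(x z, z) - (x s, s)‖ ≤ (M + 1) * (z - s) := by
    rw [Prod.mk_sub_mk, Prod.norm_mk, Real.norm_eq_abs, abs_of_pos hzs]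
    have := hmove z ⟨hz.1.le, le_rfl⟩
    exact max_le (by linarith) (by nlinarith [hF.bound_nonneg])
  have hrem : v (x z, z) - v (x s, s) - ℓ (x z - x s, z - s) ≤ r / 2 * (z - s) := by
    refine (le_abs_self _).trans (hz1.trans ?_)
    refine (mul_le_mul_of_nonneg_left hdisp hc.le).trans (le_of_eq ?_)
    field_simp
  rw [slope_def_field, div_lt_iff₀ hzs]
  nlinarith

/-- Consider the first time `τ` outside `S`. Up to and including `τ` the trajectory lies in `closure
S`, where `G` agrees with `F` and `v` is nonincreasing, and this forces `h (x τ) < 0`. -/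
theorem IsTrajectoryOn.mem_of_barrier (hF : IsBoundedLipschitzField F D L M)
    {d : ℝ → EuclideanSpace ℝ (Fin m)} (hd : IsDisturbance D d)
    {x₀ : EuclideanSpace ℝ (Fin n)} {T : ℝ} {x : ℝ → EuclideanSpace ℝ (Fin n)}
    {G : EuclideanSpace ℝ (Fin n) → EuclideanSpace ℝ (Fin m) → EuclideanSpace ℝ (Fin n)}
    (hx : IsTrajectoryOn G d x₀ T x) {S : Set (EuclideanSpace ℝ (Fin n))} (hSo : IsOpen S)
    (hGF : ∀ y ∈ closure S, G y = F y) (hx₀ : x₀ ∈ S) {h : EuclideanSpace ℝ (Fin n) → ℝ}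
    (hS : S = {x | h x < 0}) {v : EuclideanSpace ℝ (Fin n) × ℝ → ℝ}
    {v' : EuclideanSpace ℝ (Fin n) × ℝ → (EuclideanSpace ℝ (Fin n) × ℝ →L[ℝ] ℝ)}
    (hv : ∀ p ∈ closure S ×ˢ Icc 0 T, HasFDerivWithinAt v (v' p) (closure S ×ˢ Icc 0 T) p)
    (hv₀ : v (x₀, 0) < 0) (hhv : ∀ x ∈ closure S, ∀ t ∈ Icc 0 T, h x - v (x, t) ≤ 0)
    (hLie : ∀ x ∈ closure S, ∀ d ∈ D, ∀ t ∈ Icc 0 T, lieDeriv F v' x t d ≤ 0)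
    {t : ℝ} (ht : t ∈ Icc 0 T) : x t ∈ S := by
  by_contra hxt
  set A := Icc 0 T ∩ x ⁻¹' Sᶜ with hA
  have hAc : IsCompact A :=
    isCompact_Icc.of_isClosed_subset
      (hx.continuousOn.preimage_isClosed_of_isClosed isClosed_Icc hSo.isClosed_compl)
      inter_subset_left
  obtain ⟨τ, hτA, hτmin⟩ := hAc.exists_isLeast ⟨t, ht, hxt⟩
  have hτ : τ ∈ Icc 0 T := hτA.1
  have hbefore : ∀ s ∈ Ico 0 τ, x s ∈ S := fun s hs => by
    by_contra hxs
    exact absurd (hτmin ⟨⟨hs.1, hs.2.le.trans hτ.2⟩, hxs⟩) (not_le.2 hs.2)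
  have hτ0 : 0 < τ := by
    refine lt_of_le_of_ne hτ.1 fun h0 => hτA.2 ?_
    rw [← h0, hx.apply_zero (hτ.1.trans hτ.2)]
    exact hx₀
  have hτcl : x τ ∈ closure S := by
    have h1 : ContinuousWithinAt x (Ico 0 τ) τ :=
      (hx.continuousOn τ hτ).mono fun s hs => ⟨hs.1, hs.2.le.trans hτ.2⟩
    refine h1.mem_closure ?_ hbefore
    rw [closure_Ico hτ0.ne]
    exact ⟨hτ.1, le_rfl⟩
  have hcl : ∀ s ∈ Icc 0 τ, x s ∈ closure S := fun s hs => by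
    rcases hs.2.lt_or_eq with h1 | rfl
    · exact subset_closure (hbefore s ⟨hs.1, h1⟩)
    · exact hτcl
  have hxF : IsTrajectoryOn F d x₀ τ x :=
    (hx.mono hτ.1 hτ.2).congr_field hτ.1 fun s hs => hGF _ (hcl s hs)
  have h1 := hxF.apply_le_apply_zero hF hd hτ.2 hcl hv hLie ⟨hτ.1, le_rfl⟩
  have h2 := hhv _ hτcl τ hτ
  refine hτA.2 ?_
  rw [hS]
  change h (x τ) < 0
  linarith

end FiniteTimeSafety

/-! ### Compactness of trajectories and the uniform margin -/

namespace FiniteTimeSafety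

open Filter Topology

variable {n m : ℕ} {D : Set (EuclideanSpace ℝ (Fin m))} {L M : ℝ}

/-- An ultrafilter gives limits at all times simultaneously, with no extraction of subsequences. -/
theorem exists_tendsto_ultrafilter {ι : Type*} (𝒰 : Ultrafilter ι) {k : ℕ}
    {u : ι → EuclideanSpace ℝ (Fin k)} {C : ℝ} (hu : ∀ i, ‖u i‖ ≤ C) :
    ∃ l, Tendsto u 𝒰 (𝓝 l) := by
  obtain ⟨l, -, hl⟩ := (isCompact_closedBall (0 : EuclideanSpace ℝ (Fin k)) C).ultrafilter_le_nhds
    (𝒰.map u) (by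
      rw [le_principal_iff]
      exact Filter.mem_map.2 (Eventually.of_forall fun i => by simpa using hu i))
  exact ⟨l, hl⟩

theorem inv_smul_integral_mem (hDc : IsClosed D) (hDconv : Convex ℝ D)
    {d : ℝ → EuclideanSpace ℝ (Fin m)} (hdD : ∀ t, d t ∈ D)
    (hint : ∀ a b, IntervalIntegrable d volume a b) {s t : ℝ} (hst : s < t) :
    (t - s)⁻¹ • ∫ r in s..t, d r ∈ D := by
  have h1 := hDconv.set_average_mem (μ := volume) (t := Ioc s t) (f := d) hDc
    (by simp [hst]) (by simp) (Eventually.of_forall hdD) (hint s t).1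
  rwa [setAverage_eq, Real.volume_real_Ioc_of_le hst.le,
    ← intervalIntegral.integral_of_le hst.le] at h1

theorem lipschitzWith_of_tendsto {ι : Type*} {𝒰 : Ultrafilter ι} {k : ℕ} {C : ℝ} (hC : 0 ≤ C)
    {u : ι → ℝ → EuclideanSpace ℝ (Fin k)} {w : ℝ → EuclideanSpace ℝ (Fin k)}
    (hu : ∀ i s t, ‖u i t - u i s‖ ≤ C * |t - s|)
    (hw : ∀ t, Tendsto (fun i => u i t) 𝒰 (𝓝 (w t))) : LipschitzWith ⟨C, hC⟩ w := by
  refine LipschitzWith.of_dist_le_mul fun t s => ?_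
  rw [dist_eq_norm, Real.dist_eq]
  exact le_of_tendsto ((hw t).sub (hw s)).norm (Eventually.of_forall fun i => hu i s t)

section Limit

variable {f₁ : EuclideanSpace ℝ (Fin n) → EuclideanSpace ℝ (Fin n)}
  {f₂ : EuclideanSpace ℝ (Fin n) → (EuclideanSpace ℝ (Fin m) →L[ℝ] EuclideanSpace ℝ (Fin n))}

/-- Affinity in `d` lets the time average pass inside the field; the averaged disturbance is again a
value in `D` by convexity (`inv_smul_integral_mem`). -/
theorem integral_field (x : EuclideanSpace ℝ (Fin n)) {d : ℝ → EuclideanSpace ℝ (Fin m)}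
    {s t : ℝ} (hd : IntervalIntegrable d volume s t) (hst : s < t) :
    ∫ r in s..t, field f₁ f₂ x (d r) =
      (t - s) • field f₁ f₂ x ((t - s)⁻¹ • ∫ r in s..t, d r) := by
  have hne : t - s ≠ 0 := (sub_pos.2 hst).ne'
  simp only [field]
  rw [intervalIntegral.integral_add intervalIntegrable_const
    ⟨(f₂ x).integrable_comp hd.1, (f₂ x).integrable_comp hd.2⟩, intervalIntegral.integral_const,
    (f₂ x).intervalIntegral_comp_comm hd, smul_add, map_smul, smul_smul, mul_inv_cancel₀ hne,
    one_smul]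

/-- The increment of a trajectory is approximated by the vector field, frozen at a state `y`, at
the average of the disturbance. -/
theorem norm_trajectory_sub_field_average_le
    (hF : IsBoundedLipschitzField (field f₁ f₂) D L M) {d : ℝ → EuclideanSpace ℝ (Fin m)}
    (hd : IsDisturbance D d) {x₀ : EuclideanSpace ℝ (Fin n)} {a : ℝ}
    {x : ℝ → EuclideanSpace ℝ (Fin n)} (hx : IsTrajectoryOn (field f₁ f₂) d x₀ a x) {s t : ℝ}
    (hs : 0 ≤ s) (hst : s < t) (hta : t ≤ a) (hdi : IntervalIntegrable d volume s t)
    (y : EuclideanSpace ℝ (Fin n)) :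
    ‖x t - x s - (t - s) • field f₁ f₂ y ((t - s)⁻¹ • ∫ r in s..t, d r)‖
      ≤ L * (M * (t - s) + ‖x s - y‖) * (t - s) := by
  have hs' : s ∈ Icc 0 a := ⟨hs, hst.le.trans hta⟩
  have ht' : t ∈ Icc 0 a := ⟨hs.trans hst.le, hta⟩
  rw [hx.sub_eq_integral hs' ht', ← integral_field y hdi hst, ← intervalIntegral.integral_sub
    (hx.intervalIntegrable hs' ht')]
  swap
  · simp only [field]
    exact intervalIntegrable_const.add
      ⟨(f₂ y).integrable_comp hdi.1, (f₂ y).integrable_comp hdi.2⟩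
  have h2 := intervalIntegral.norm_integral_le_of_norm_le_const (a := s) (b := t)
    (f := fun r => field f₁ f₂ (x r) (d r) - field f₁ f₂ y (d r))
    (C := L * (M * (t - s) + ‖x s - y‖)) fun r hr => by
      rw [uIoc_of_le hst.le] at hr
      refine (hF.norm_sub_le _ _ _ (hd.2 r (hs.trans hr.1.le))).trans
        (mul_le_mul_of_nonneg_left ?_ hF.lipschitz_pos.le)
      have h3 := hx.norm_sub_le hF hd hs' (t := r) ⟨hs.trans hr.1.le, hr.2.trans hta⟩
      rw [abs_of_pos (sub_pos.2 hr.1)] at h3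
      have h4 := mul_le_mul_of_nonneg_left (sub_le_sub_right hr.2 s) hF.bound_nonneg
      have h5 := norm_sub_le_norm_sub_add_norm_sub (x r) (x s) y
      linarith
  rwa [abs_of_pos (sub_pos.2 hst)] at h2

/-- A Lipschitz curve with increments approximated to second order by the vector field at difference
quotients of a Lipschitz curve `Δ` solves the equation driven by the derivative of `Δ`. -/
theorem hasDerivAt_field_deriv {x : ℝ → EuclideanSpace ℝ (Fin n)} {Δ : ℝ → EuclideanSpace ℝ (Fin m)} {t : ℝ}
    (happrox : ∀ z, t < z →
      ‖x z - x t - (z - t) • field f₁ f₂ (x t) ((z - t)⁻¹ • (Δ z - Δ t))‖ ≤ L * M * (z - t) ^ 2)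
    (hx : DifferentiableAt ℝ x t) (hΔ : DifferentiableAt ℝ Δ t) :
    HasDerivAt x (field f₁ f₂ (x t) (deriv Δ t)) t := by
  have hxs := (hasDerivAt_iff_tendsto_slope.1 hx.hasDerivAt).mono_left (nhdsGT_le_nhdsNE t)
  have hΔs := (hasDerivAt_iff_tendsto_slope.1 hΔ.hasDerivAt).mono_left (nhdsGT_le_nhdsNE t)
  have hcont : Continuous (field f₁ f₂ (x t)) := (f₂ (x t)).continuous.const_add (f₁ (x t))
  have hFs : Tendsto (fun z => field f₁ f₂ (x t) (slope Δ t z)) (𝓝[>] t)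
      (𝓝 (field f₁ f₂ (x t) (deriv Δ t))) := (hcont.tendsto _).comp hΔs
  have hdiff : Tendsto (fun z => slope x t z - field f₁ f₂ (x t) (slope Δ t z)) (𝓝[>] t)
      (𝓝 0) := by
    have hlim : Tendsto (fun z => L * M * (z - t)) (𝓝[>] t) (𝓝 0) := by
      have : Tendsto (fun z => L * M * (z - t)) (𝓝 t) (𝓝 (L * M * (t - t))) :=
        (by fun_prop : Continuous fun z => L * M * (z - t)).tendsto t
      rw [sub_self, mul_zero] at this
      exact this.mono_left nhdsWithin_le_nhds
    refine squeeze_zero_norm' ?_ hlim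
    filter_upwards [self_mem_nhdsWithin] with z hz
    have hzt : 0 < z - t := sub_pos.2 hz
    have h1 : slope x t z - field f₁ f₂ (x t) (slope Δ t z) =
        (z - t)⁻¹ • (x z - x t - (z - t) • field f₁ f₂ (x t) ((z - t)⁻¹ • (Δ z - Δ t))) := by
      rw [smul_sub _ (x z - x t), smul_smul, inv_mul_cancel₀ hzt.ne', one_smul]
      rfl
    rw [h1, norm_smul, norm_inv, Real.norm_eq_abs, abs_of_pos hzt, inv_mul_le_iff₀ hzt]
    refine (happrox z hz).trans (le_of_eq (by ring))
  have heq : deriv x t = field f₁ f₂ (x t) (deriv Δ t) := by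
    have h2 := hdiff.add hFs
    simp only [sub_add_cancel, zero_add] at h2
    exact tendsto_nhds_unique hxs h2
  rw [← heq]
  exact hx.hasDerivAt

/-- The difference of `y` and the primitive of `g` is Lipschitz, hence absolutely continuous, with
derivative zero almost everywhere; so it is constant. -/
theorem eq_add_integral_of_ae_hasDerivAt {y g : ℝ → EuclideanSpace ℝ (Fin n)} {K : NNReal}
    (hy : LipschitzWith K y) (hM : 0 ≤ M) (hg : ∀ s, ‖g s‖ ≤ M)
    (hint : ∀ a b, IntervalIntegrable g volume a b)
    (hderiv : ∀ᵐ t, 0 ≤ t → HasDerivAt y (g t) t) {t : ℝ} (ht : 0 ≤ t) :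
    y t = y 0 + ∫ s in (0 : ℝ)..t, g s := by
  have hlip : LipschitzWith ⟨M, hM⟩ fun t => ∫ s in (0 : ℝ)..t, g s := by
    refine LipschitzWith.of_dist_le_mul fun a b => ?_
    rw [dist_eq_norm, Real.dist_eq,
      intervalIntegral.integral_interval_sub_left (hint 0 a) (hint 0 b)]
    exact intervalIntegral.norm_integral_le_of_norm_le_const fun s _ => hg s
  have hac : AbsolutelyContinuousOnInterval (fun t => y t - ∫ s in (0 : ℝ)..t, g s) 0 t :=
    (hy.lipschitzOnWith (s := uIcc 0 t)).absolutelyContinuousOnInterval.fun_sub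
      (hlip.lipschitzOnWith (s := uIcc 0 t)).absolutelyContinuousOnInterval
  obtain ⟨c, hc⟩ := hac.const_of_ae_hasDerivAt_zero (by
    filter_upwards [hderiv, (hint 0 t).ae_hasDerivAt_integral] with s h1 h2 hs
    have hs0 : 0 ≤ s := by rw [uIcc_of_le ht] at hs; exact hs.1
    have h3 := (h1 hs0).sub (h2 hs 0 left_mem_uIcc)
    rw [sub_self] at h3
    exact h3)
  have h1 := hc 0 left_mem_uIcc
  have h2 := hc t right_mem_uIcc
  simp only [intervalIntegral.integral_same, sub_zero] at h1
  rw [h1, ← h2]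
  abel

/-- A Lipschitz curve whose increments are approximated to second order by the vector field at
difference quotients of a Lipschitz curve, these quotients lying in `D`, is a trajectory. -/
theorem exists_isTrajectoryOn_of_difference_quotients
    (hF : IsBoundedLipschitzField (field f₁ f₂) D L M) (hD : IsClosed D) (hDne : D.Nonempty)
    {y : ℝ → EuclideanSpace ℝ (Fin n)} {Δ : ℝ → EuclideanSpace ℝ (Fin m)} {K K' : NNReal}
    (hy : LipschitzWith K y) (hΔ : LipschitzWith K' Δ)
    (hslope : ∀ s t, s < t → (t - s)⁻¹ • (Δ t - Δ s) ∈ D)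
    (happrox : ∀ s t, 0 ≤ s → s < t →
      ‖y t - y s - (t - s) • field f₁ f₂ (y s) ((t - s)⁻¹ • (Δ t - Δ s))‖
        ≤ L * M * (t - s) ^ 2) :
    ∃ e, IsDisturbance D e ∧ ∀ a, 0 ≤ a → IsTrajectoryOn (field f₁ f₂) e (y 0) a y := by
  obtain ⟨d₀, hd₀⟩ := hDne
  classical
  -- The derivative of `Δ` lies in `D` wherever it exists, as a limit of difference quotients. On
  -- the remaining null set `d₀` keeps `e` admissible.
  set e : ℝ → EuclideanSpace ℝ (Fin m) := fun t => if deriv Δ t ∈ D then deriv Δ t else d₀ with he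
  have heD : ∀ t, e t ∈ D := fun t => by
    simp only [he]
    split_ifs with h
    · exact h
    · exact hd₀
  have hem : Measurable e :=
    Measurable.ite (measurable_deriv Δ hD.measurableSet) (measurable_deriv Δ)
      measurable_const
  have hderiv : ∀ᵐ t, 0 ≤ t → HasDerivAt y (field f₁ f₂ (y t) (e t)) t := by
    filter_upwards [hΔ.ae_differentiableAt_real, hy.ae_differentiableAt_real] with t h1 h2 ht
    have hmem : deriv Δ t ∈ D := by
      have h3 := (hasDerivAt_iff_tendsto_slope.1 h1.hasDerivAt).mono_left
        (nhdsGT_le_nhdsNE t)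
      refine hD.mem_of_tendsto h3 ?_
      filter_upwards [self_mem_nhdsWithin] with z hz using hslope t z hz
    simp only [he, if_pos hmem]
    exact hasDerivAt_field_deriv (fun z hz => happrox t z ht hz) h2 h1
  have hint : ∀ a b, IntervalIntegrable (fun s => field f₁ f₂ (y s) (e s)) volume a b :=
    hF.intervalIntegrable hem heD hy.continuous.measurable
  refine ⟨e, ⟨hem, fun t _ => heD t⟩, fun a ha =>
    ⟨hy.continuous.continuousOn, hint 0 a, fun t ht => ?_⟩⟩
  exact eq_add_integral_of_ae_hasDerivAt hy hF.bound_nonneg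
    (fun s => hF.norm_le _ _ (heD s)) hint hderiv ht.1

/-- A pointwise limit of trajectories along an ultrafilter is a trajectory. -/
theorem exists_trajectory_of_tendsto (hF : IsBoundedLipschitzField (field f₁ f₂) D L M)
    (hD : IsCompact D) (hDconv : Convex ℝ D) (hDne : D.Nonempty)
    {X₀ : Set (EuclideanSpace ℝ (Fin n))} (hX₀ : IsCompact X₀) {ι : Type*} (𝒰 : Ultrafilter ι)
    {x₀ : ι → EuclideanSpace ℝ (Fin n)} (hx₀ : ∀ i, x₀ i ∈ X₀)
    {d : ι → ℝ → EuclideanSpace ℝ (Fin m)} (hd : ∀ i, IsDisturbance D (d i))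
    {x : ι → ℝ → EuclideanSpace ℝ (Fin n)}
    (hx : ∀ i a, 0 ≤ a → IsTrajectoryOn (field f₁ f₂) (d i) (x₀ i) a (x i)) :
    ∃ y₀ ∈ X₀, ∃ e, IsDisturbance D e ∧ ∃ y,
      (∀ a, 0 ≤ a → IsTrajectoryOn (field f₁ f₂) e y₀ a y) ∧
      ∀ t, 0 ≤ t → Tendsto (fun i => x i t) 𝒰 (𝓝 (y t)) := by
  obtain ⟨C, hC⟩ := hD.isBounded.exists_norm_le
  obtain ⟨B, hB⟩ := hX₀.isBounded.exists_norm_le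
  obtain ⟨d₀, hd₀⟩ := hDne
  have hC0 : 0 ≤ C := (norm_nonneg _).trans (hC d₀ hd₀)
  have hM := hF.bound_nonneg
  have hmax : ∀ t : ℝ, 0 ≤ max t 0 := fun t => le_max_right _ _
  -- the disturbances on the whole line and their primitives
  set d' : ι → ℝ → EuclideanSpace ℝ (Fin m) := fun i t => d i (max t 0) with hd'
  have hd'D : ∀ i t, d' i t ∈ D := fun i t => (hd i).2 _ (hmax t)
  have hd'm : ∀ i, Measurable (d' i) := fun i =>
    (hd i).1.comp (measurable_id.max measurable_const)
  have hd'int : ∀ i a b, IntervalIntegrable (d' i) volume a b := fun i a b =>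
    (intervalIntegrable_const (c := C)).mono_fun (hd'm i).aestronglyMeasurable
      (Eventually.of_forall fun s => (hC _ (hd'D i s)).trans (le_abs_self C))
  have hd'dist : ∀ i, IsDisturbance D (d' i) := fun i => ⟨hd'm i, fun t _ => hd'D i t⟩
  have hx' : ∀ i a, 0 ≤ a → IsTrajectoryOn (field f₁ f₂) (d' i) (x₀ i) a (x i) := fun i a ha =>
    (hx i a ha).congr_disturbance ha fun t ht => by simp only [hd', max_eq_left ht.1]
  -- The disturbances themselves need not converge pointwise; their primitives are equi-Lipschitz
  -- and do.
  set Δ : ι → ℝ → EuclideanSpace ℝ (Fin m) := fun i t => ∫ s in (0 : ℝ)..t, d' i s with hΔ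
  have hΔsub : ∀ i s t, Δ i t - Δ i s = ∫ r in s..t, d' i r := fun i s t =>
    intervalIntegral.integral_interval_sub_left (hd'int i _ _) (hd'int i _ _)
  have hΔlip : ∀ i s t, ‖Δ i t - Δ i s‖ ≤ C * |t - s| := fun i s t => by
    rw [hΔsub]
    exact intervalIntegral.norm_integral_le_of_norm_le_const fun r _ => hC _ (hd'D i r)
  have hxlip : ∀ i s t, ‖x i (max t 0) - x i (max s 0)‖ ≤ M * |t - s| := fun i s t => by
    have ha : 0 ≤ max (max s 0) (max t 0) := (hmax s).trans (le_max_left _ _)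
    refine ((hx i _ ha).norm_sub_le hF (hd i) ⟨hmax s, le_max_left _ _⟩
      ⟨hmax t, le_max_right _ _⟩).trans (mul_le_mul_of_nonneg_left ?_ hM)
    exact abs_max_sub_max_le_abs t s 0
  have hx0 : ∀ i, x i 0 = x₀ i := fun i => (hx i 0 le_rfl).apply_zero le_rfl
  -- pointwise limits
  have hlimΔ : ∀ t, ∃ l, Tendsto (fun i => Δ i t) 𝒰 (𝓝 l) := fun t =>
    exists_tendsto_ultrafilter 𝒰 (C := C * |t|) fun i => by
      have := hΔlip i 0 t
      simpa [hΔ] using this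
  have hlimx : ∀ t, ∃ l, Tendsto (fun i => x i (max t 0)) 𝒰 (𝓝 l) := fun t =>
    exists_tendsto_ultrafilter 𝒰 (C := B + M * |t|) fun i => by
      have h1 := hxlip i 0 t
      rw [max_self, hx0, sub_zero] at h1
      have h2 := norm_add_le (x i (max t 0) - x₀ i) (x₀ i)
      rw [sub_add_cancel] at h2
      linarith [hB _ (hx₀ i)]
  choose Δ' hΔ' using hlimΔ
  choose y hy using hlimx
  have hΔ'lip := lipschitzWith_of_tendsto hC0 hΔlip hΔ'
  have hylip := lipschitzWith_of_tendsto hM hxlip hy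
  have hyt : ∀ t, 0 ≤ t → Tendsto (fun i => x i t) 𝒰 (𝓝 (y t)) := fun t ht => by
    have := hy t
    rwa [max_eq_left ht] at this
  have hy0 : y 0 ∈ X₀ := by
    have h1 := hyt 0 le_rfl
    simp only [hx0] at h1
    exact hX₀.isClosed.mem_of_tendsto h1 (Eventually.of_forall hx₀)
  -- difference quotients of the limit primitive
  have hslope_tendsto : ∀ s t, Tendsto (fun i => (t - s)⁻¹ • ∫ r in s..t, d' i r) 𝒰
      (𝓝 ((t - s)⁻¹ • (Δ' t - Δ' s))) := fun s t => by
    simp only [← hΔsub]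
    exact ((hΔ' t).sub (hΔ' s)).const_smul _
  have hslope : ∀ s t, s < t → (t - s)⁻¹ • (Δ' t - Δ' s) ∈ D := fun s t hst =>
    hD.isClosed.mem_of_tendsto (hslope_tendsto s t) (Eventually.of_forall fun i =>
      inv_smul_integral_mem hD.isClosed hDconv (hd'D i) (hd'int i) hst)
  have happrox : ∀ s t, 0 ≤ s → s < t →
      ‖y t - y s - (t - s) • field f₁ f₂ (y s) ((t - s)⁻¹ • (Δ' t - Δ' s))‖
        ≤ L * M * (t - s) ^ 2 := by
    intro s t hs hst
    have ht : 0 ≤ t := hs.trans hst.le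
    have hcont : Continuous (field f₁ f₂ (y s)) := (f₂ (y s)).continuous.const_add (f₁ (y s))
    have hlhs := (((hyt t ht).sub (hyt s hs)).sub
      (((hcont.tendsto _).comp (hslope_tendsto s t)).const_smul (t - s))).norm
    -- Freezing the state at the limit `y s` costs `‖x i s - y s‖`, which disappears in the limit.
    have hrhs : Tendsto (fun i => L * (M * (t - s) + ‖x i s - y s‖) * (t - s)) 𝒰
        (𝓝 (L * (M * (t - s) + ‖y s - y s‖) * (t - s))) :=
      ((((hyt s hs).sub_const (y s)).norm.const_add _).const_mul L).mul_const _
    refine (le_of_tendsto_of_tendsto' hlhs hrhs fun i => ?_).trans (le_of_eq ?_)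
    · exact norm_trajectory_sub_field_average_le hF (hd'dist i) (hx' i t ht) hs hst le_rfl
        (hd'int i _ _) (y s)
    · rw [sub_self, norm_zero]; ring
  obtain ⟨e, he, hey⟩ := exists_isTrajectoryOn_of_difference_quotients hF hD.isClosed ⟨d₀, hd₀⟩
    hylip hΔ'lip hslope happrox
  exact ⟨y 0, hy0, e, he, y, hey, hyt⟩

/-- Safety is uniform: on reachable states up to time `T`, a continuous function that is negative on
`S` is bounded away from zero. -/
theorem exists_forall_reachSet_le (hF : IsBoundedLipschitzField (field f₁ f₂) D L M)
    (hD : IsCompact D) (hDconv : Convex ℝ D) (hDne : D.Nonempty)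
    {X₀ : Set (EuclideanSpace ℝ (Fin n))} (hX₀ : IsCompact X₀) {T : ℝ}
    {h : EuclideanSpace ℝ (Fin n) → ℝ} (hh : Continuous h)
    (hneg : ∀ t ∈ Icc 0 T, ∀ p ∈ reachSet (field f₁ f₂) D X₀ t, h p < 0) :
    ∃ δ > 0, ∀ t ∈ Icc 0 T, ∀ p ∈ reachSet (field f₁ f₂) D X₀ t, h p ≤ -δ := by
  by_contra! hcon
  have hseq : ∀ k : ℕ, ∃ t ∈ Icc 0 T, ∃ p ∈ reachSet (field f₁ f₂) D X₀ t,
      -(1 / ((k : ℝ) + 1)) < h p := fun k => hcon _ (by positivity)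
  choose t ht p hp hpt using hseq
  choose x₀ hx₀ d hd x hx hxp using hp
  obtain ⟨y₀, hy₀, e, he, y, hy, hlim⟩ := exists_trajectory_of_tendsto hF hD hDconv hDne hX₀
    (hyperfilter ℕ) hx₀ hd hx
  obtain ⟨τ, hτ, htτ⟩ := isCompact_Icc.ultrafilter_le_nhds ((hyperfilter ℕ).map t)
    (by rw [le_principal_iff]; exact Filter.mem_map.2 (Eventually.of_forall ht))
  have htτ' : Tendsto t (hyperfilter ℕ) (𝓝 τ) := htτ
  -- The states are taken at varying times `t k`; the common speed bound `M` allows them to be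
  -- compared at the limit time `τ`.
  have hxτ : Tendsto p (hyperfilter ℕ) (𝓝 (y τ)) := by
    have h1 := hlim τ hτ.1
    have h2 : Tendsto (fun k => p k - x k τ) (hyperfilter ℕ) (𝓝 0) := by
      have h3 : Tendsto (fun k => M * |t k - τ|) (hyperfilter ℕ) (𝓝 (M * |τ - τ|)) :=
        ((htτ'.sub_const τ).abs).const_mul M
      rw [sub_self, abs_zero, mul_zero] at h3
      refine squeeze_zero_norm (fun k => ?_) h3
      rw [← hxp k]
      exact (hx k T (hτ.1.trans hτ.2)).norm_sub_le hF (hd k) hτ (ht k)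
    have h4 := h2.add h1
    simpa using h4
  have hzero : Tendsto (fun k : ℕ => -(1 / ((k : ℝ) + 1))) (hyperfilter ℕ) (𝓝 (-0)) :=
    ((tendsto_one_div_add_atTop_nhds_zero_nat (𝕜 := ℝ)).mono_left
      (by rw [← Nat.cofinite_eq_atTop]; exact hyperfilter_le_cofinite)).neg
  have hge : -(0 : ℝ) ≤ h (y τ) :=
    le_of_tendsto_of_tendsto' hzero ((hh.tendsto _).comp hxτ) fun k => (hpt k).le
  have := hneg τ hτ (y τ) ⟨y₀, hy₀, e, he, y, hy, rfl⟩
  linarith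

end Limit

end FiniteTimeSafety

/-! ### Mollification -/

namespace FiniteTimeSafety

open Filter Topology Convolution

variable {n m : ℕ}
  {F : EuclideanSpace ℝ (Fin n) → EuclideanSpace ℝ (Fin m) → EuclideanSpace ℝ (Fin n)}
  {D : Set (EuclideanSpace ℝ (Fin m))} {L M : ℝ}

/-- Mollifying a Lipschitz function that grows at most at rate `L` along `F`. -/
theorem exists_contDiff_lieDeriv_le (hF : IsBoundedLipschitzField F D L M)
    {u : EuclideanSpace ℝ (Fin n) × ℝ → ℝ} {K A η : ℝ} (hK : 0 ≤ K) (hη : 0 < η)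
    (hlip : ∀ p q, |u p - u q| ≤ K * ‖p - q‖)
    (hgrow : ∀ e ∈ D, ∀ x t s, 0 ≤ t → 0 ≤ s →
      u (x + s • F x e, t + s) ≤ (1 + L * s) * u (x, t) + A * s ^ 2) :
    ∃ w : EuclideanSpace ℝ (Fin n) × ℝ → ℝ, ContDiff ℝ 1 w ∧ (∀ p, |w p - u p| ≤ K * η) ∧
      ∀ x t, η ≤ t → ∀ e ∈ D, fderiv ℝ w (x, t) (F x e, 1) ≤ L * w (x, t) + K * L * η := by
  have huc : Continuous u := by
    refine (LipschitzWith.of_dist_le_mul (K := ⟨K, hK⟩) fun p q => ?_).continuous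
    rw [Real.dist_eq, dist_eq_norm]
    exact hlip p q
  have hL := hF.lipschitz_pos
  have : (volume : Measure (EuclideanSpace ℝ (Fin n) × ℝ)).IsAddHaarMeasure := by
    rw [Measure.volume_eq_prod]; infer_instance
  let φ : ContDiffBump (0 : EuclideanSpace ℝ (Fin n) × ℝ) := ⟨η / 2, η, by positivity, by linarith⟩
  set ψ : EuclideanSpace ℝ (Fin n) × ℝ → ℝ := φ.normed volume with hψ
  have hψ0 : ∀ y, 0 ≤ ψ y := φ.nonneg_normed
  have hψc : Continuous ψ := φ.continuous_normed
  have hψi : ∫ y, ψ y = 1 := φ.integral_normed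
  have hψs : ∀ y, η ≤ ‖y‖ → ψ y = 0 := fun y hy => by
    by_contra hne
    have h1 : y ∈ Function.support ψ := hne
    rw [hψ, φ.support_normed_eq] at h1
    have h2 : ‖y‖ < η := by simpa using h1
    exact absurd hy (not_le.2 h2)
  have hint : ∀ g : EuclideanSpace ℝ (Fin n) × ℝ → ℝ, Continuous g →
      Integrable fun y => ψ y * g y := fun g hg =>
    (hψc.mul hg).integrable_of_hasCompactSupport φ.hasCompactSupport_normed.mul_right
  set w : EuclideanSpace ℝ (Fin n) × ℝ → ℝ :=
    ψ ⋆[ContinuousLinearMap.lsmul ℝ ℝ, volume] u with hw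
  have hwint : ∀ q, w q = ∫ y, ψ y * u (q - y) := fun q => rfl
  have hwc : ContDiff ℝ 1 w :=
    φ.hasCompactSupport_normed.contDiff_convolution_left _ φ.contDiff_normed
      huc.locallyIntegrable
  have hushift : ∀ q, Continuous fun y => u (q - y) := fun q =>
    huc.comp (continuous_const.sub continuous_id)
  refine ⟨w, hwc, fun p => ?_, fun x t ht e he => ?_⟩
  · have := φ.dist_normed_convolution_le (μ := volume) (g := u) (x₀ := p) (ε := K * η)
      huc.aestronglyMeasurable fun q hq => by
        rw [Real.dist_eq]
        refine (hlip q p).trans (mul_le_mul_of_nonneg_left ?_ hK)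
        rw [← dist_eq_norm]
        exact (Metric.mem_ball.1 hq).le
    rwa [Real.dist_eq] at this
  -- The growth bound is averaged over shifts `y` with `‖y‖ < η`. At the shifted point it involves
  -- `F (x - y.1) e` rather than `F x e`, which costs `K * L * η * s`; `η ≤ t` keeps the shifted
  -- times nonnegative.
  · have hincr : ∀ s, 0 ≤ s → w ((x, t) + s • (F x e, (1 : ℝ)))
        ≤ (1 + L * s) * w (x, t) + (K * L * η * s + A * s ^ 2) := by
      intro s hs
      have hconst : ∫ y, ψ y * (K * L * η * s + A * s ^ 2) = K * L * η * s + A * s ^ 2 := by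
        rw [integral_mul_const, hψi, one_mul]
      rw [hwint, hwint, ← integral_const_mul, ← hconst, ← integral_add
        ((hint _ (hushift _)).const_mul _) (hint _ continuous_const)]
      refine integral_mono (hint _ (hushift _))
        (((hint _ (hushift _)).const_mul _).add (hint _ continuous_const)) fun y => ?_
      simp only
      rcases le_or_gt η ‖y‖ with hy | hy
      · rw [hψs y hy]; simp
      have hy1 : ‖y.1‖ ≤ η := (norm_fst_le y).trans hy.le
      have hy2 : y.2 ≤ η := (le_abs_self _).trans ((norm_snd_le y).trans hy.le)
      have h1 := hgrow e he (x - y.1) (t - y.2) s (by linarith) hs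
      have h2 := (le_abs_self _).trans (hlip ((x, t) + s • (F x e, (1 : ℝ)) - y)
        (x - y.1 + s • F (x - y.1) e, t - y.2 + s))
      have h3 : (x, t) + s • (F x e, (1 : ℝ)) - y - (x - y.1 + s • F (x - y.1) e, t - y.2 + s)
          = (s • (F x e - F (x - y.1) e), 0) := by
        ext1
        · simp only [Prod.fst_sub, Prod.fst_add, Prod.smul_fst, smul_sub]; abel
        · simp only [Prod.snd_sub, Prod.snd_add, Prod.smul_snd, smul_eq_mul]; ring
      have h4 : ‖F x e - F (x - y.1) e‖ ≤ L * η := by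
        refine (hF.norm_sub_le _ _ _ he).trans (mul_le_mul_of_nonneg_left ?_ hL.le)
        rwa [sub_sub_cancel]
      rw [h3, Prod.norm_mk, norm_zero, max_eq_left (norm_nonneg _), norm_smul, Real.norm_eq_abs,
        abs_of_nonneg hs] at h2
      have h5 := mul_le_mul_of_nonneg_left (mul_le_mul_of_nonneg_left h4 hs) hK
      have h6 : (x, t) - y = (x - y.1, t - y.2) := rfl
      rw [h6]
      have h7 := mul_le_mul_of_nonneg_left (a := ψ y)
        (show u ((x, t) + s • (F x e, (1 : ℝ)) - y) ≤ (1 + L * s) * u (x - y.1, t - y.2)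
          + (K * L * η * s + A * s ^ 2) by linarith) (hψ0 y)
      linarith
    have hdir : HasDerivAt (fun s : ℝ => w ((x, t) + s • (F x e, (1 : ℝ))))
        (fderiv ℝ w (x, t) (F x e, 1)) 0 := by
      have h1 : HasFDerivAt w (fderiv ℝ w (x, t)) ((x, t) + (0 : ℝ) • (F x e, (1 : ℝ))) := by
        rw [zero_smul, add_zero]
        exact (hwc.differentiable one_ne_zero _).hasFDerivAt
      have h2 : HasDerivAt (fun s : ℝ => (x, t) + s • (F x e, (1 : ℝ))) (F x e, 1) 0 := by
        simpa using ((hasDerivAt_id (0 : ℝ)).smul_const (F x e, (1 : ℝ))).const_add (x, t)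
      exact h1.comp_hasDerivAt 0 h2
    have hslope := (hasDerivAt_iff_tendsto_slope.1 hdir).mono_left (nhdsGT_le_nhdsNE (a := 0))
    have hbound : Tendsto (fun s => L * w (x, t) + K * L * η + A * s) (𝓝[>] 0)
        (𝓝 (L * w (x, t) + K * L * η + A * 0)) :=
      ((by fun_prop : Continuous fun s => L * w (x, t) + K * L * η + A * s).tendsto 0).mono_left
        nhdsWithin_le_nhds
    rw [mul_zero, add_zero] at hbound
    -- Dividing the increment by `s` and letting `s → 0` from the right removes the second-order
    -- term.
    refine le_of_tendsto_of_tendsto hslope hbound ?_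
    filter_upwards [self_mem_nhdsWithin] with s hs
    have hs0 : 0 < s := hs
    rw [slope_def_field, div_le_iff₀ (by linarith), zero_smul, add_zero, sub_zero]
    have := hincr s hs0.le
    nlinarith

end FiniteTimeSafety

/-! ### Construction of the barrier and conclusion -/

namespace FiniteTimeSafety

open Filter Topology

variable {n m : ℕ} {D : Set (EuclideanSpace ℝ (Fin m))} {L M : ℝ}
  {S X₀ : Set (EuclideanSpace ℝ (Fin n))} {h : EuclideanSpace ℝ (Fin n) → ℝ} {T : ℝ}

theorem nonpos_of_mem_closure (hh : Continuous h) (hS : S = {x | h x < 0})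
    {x : EuclideanSpace ℝ (Fin n)} (hx : x ∈ closure S) : h x ≤ 0 := by
  refine closure_minimal (t := {x | h x ≤ 0}) ?_ (isClosed_le hh continuous_const) hx
  rw [hS]
  exact fun y (hy : h y < 0) => hy.le

/-- Under safety, trajectories of the truncated field stay in `S`. -/
theorem IsSafe.reachSet_subset
    {F G : EuclideanSpace ℝ (Fin n) → EuclideanSpace ℝ (Fin m) → EuclideanSpace ℝ (Fin n)}
    (hF : IsBoundedLipschitzField F D L M) (hGF : ∀ y ∈ S, G y = F y)
    (hsafe : IsSafe G D X₀ S T) {t : ℝ} (ht : t ∈ Icc 0 T) : reachSet F D X₀ t ⊆ S := by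
  rintro _ ⟨x₀, hx₀, d, hd, x, hx, rfl⟩
  have hT : 0 ≤ T := ht.1.trans ht.2
  obtain ⟨⟨y, hy⟩, hyS⟩ := hsafe x₀ hx₀ d hd
  have hyF : IsTrajectoryOn F d x₀ T y := hy.congr_field hT fun s hs => hGF _ (hyS y hy s hs)
  rw [(hx T hT).eqOn hF hd hyF ht]
  exact hyS y hy t ht

/-- For existence, the global trajectory of `F` is itself kept in `S` by the barrier; there the two
fields agree, so it is a trajectory of `G`. -/
theorem isSafe_of_barrier
    {F G : EuclideanSpace ℝ (Fin n) → EuclideanSpace ℝ (Fin m) → EuclideanSpace ℝ (Fin n)}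
    (hF : IsBoundedLipschitzField F D L M) (hGF : ∀ y ∈ closure S, G y = F y) (hSo : IsOpen S)
    (hS : S = {x | h x < 0}) (hX₀S : X₀ ⊆ S) (hT : 0 ≤ T)
    {v : EuclideanSpace ℝ (Fin n) × ℝ → ℝ}
    {v' : EuclideanSpace ℝ (Fin n) × ℝ → (EuclideanSpace ℝ (Fin n) × ℝ →L[ℝ] ℝ)}
    (hv : ∀ p ∈ closure S ×ˢ Icc 0 T, HasFDerivWithinAt v (v' p) (closure S ×ˢ Icc 0 T) p)
    (hv₀ : ∀ x ∈ X₀, v (x, 0) < 0) (hhv : ∀ x ∈ closure S, ∀ t ∈ Icc 0 T, h x - v (x, t) ≤ 0)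
    (hLie : ∀ x ∈ closure S, ∀ d ∈ D, ∀ t ∈ Icc 0 T, lieDeriv G v' x t d ≤ 0) :
    IsSafe G D X₀ S T := by
  have hLieF : ∀ x ∈ closure S, ∀ d ∈ D, ∀ t ∈ Icc 0 T, lieDeriv F v' x t d ≤ 0 := by
    intro x hx d hd t ht
    have := hLie x hx d hd t ht
    rwa [lieDeriv, hGF x hx] at this
  intro x₀ hx₀ d hd
  refine ⟨?_, fun x hx t ht =>
    hx.mem_of_barrier hF hd hSo hGF (hX₀S hx₀) hS hv (hv₀ x₀ hx₀) hhv hLieF ht⟩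
  obtain ⟨x, hx⟩ := hF.exists_trajectory hd x₀
  refine ⟨x, (hx T hT).congr_field hT fun t ht => (hGF _ (subset_closure ?_)).symm⟩
  exact (hx T hT).mem_of_barrier hF hd hSo (fun _ _ => rfl) (hX₀S hx₀) hS hv (hv₀ x₀ hx₀) hhv
    hLieF ht

theorem exists_barrier_of_reachSet_subset
    {f₁ : EuclideanSpace ℝ (Fin n) → EuclideanSpace ℝ (Fin n)}
    {f₂ : EuclideanSpace ℝ (Fin n) → (EuclideanSpace ℝ (Fin m) →L[ℝ] EuclideanSpace ℝ (Fin n))}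
    (hF : IsBoundedLipschitzField (field f₁ f₂) D L M) (hD : IsCompact D) (hDconv : Convex ℝ D)
    (hDne : D.Nonempty) (hX₀ : IsCompact X₀) (hX₀ne : X₀.Nonempty) (hh : Continuous h)
    (hSbdd : Bornology.IsBounded S) (hS : S = {x | h x < 0}) (hT : 0 ≤ T)
    (hreach : ∀ t ∈ Icc 0 T, reachSet (field f₁ f₂) D X₀ t ⊆ S) :
    ∃ v : EuclideanSpace ℝ (Fin n) × ℝ → ℝ, ContDiff ℝ 1 v ∧ (∀ x ∈ X₀, v (x, 0) < 0) ∧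
      (∀ x ∈ closure S, ∀ t ∈ Icc 0 T, h x ≤ v (x, t)) ∧
      ∀ x, ∀ d ∈ D, ∀ t, 0 ≤ t → lieDeriv (field f₁ f₂) (fderiv ℝ v) x t d ≤ 0 := by
  have hL := hF.lipschitz_pos
  have hM := hF.bound_nonneg
  have hcl : ∀ x ∈ closure S, h x ≤ 0 := fun x hx => nonpos_of_mem_closure hh hS hx
  obtain ⟨δ, hδ, hδh⟩ := exists_forall_reachSet_le hF hD hDconv hDne hX₀ (T := T) hh
    fun t ht p hp => by
      have := hreach t ht hp
      rw [hS] at this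
      exact this
  -- points of `closure S` where `h` is not very negative are far from the reachable set
  obtain ⟨ρ, hρ, hρh⟩ := Metric.uniformContinuousOn_iff.1
    (hSbdd.isCompact_closure.uniformContinuousOn_of_continuous hh.continuousOn) (δ / 4)
    (by positivity)
  have hfar : ∀ x ∈ closure S, ∀ t ∈ Icc 0 T, -(3 * δ / 4) < h x →
      ρ ≤ Metric.infDist x (reachSet (field f₁ f₂) D X₀ t) := by
    intro x hx t ht hhx
    refine (Metric.le_infDist (reachSet_nonempty hF hDne hX₀ne t)).2 fun p hp => ?_
    by_contra hlt
    have h1 := hρh x hx p (subset_closure (hreach t ht hp)) (not_le.1 hlt)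
    have h2 := hδh t ht p hp
    rw [Real.dist_eq] at h1
    linarith [le_abs_self (h x - h p)]
  set u := reachDist (field f₁ f₂) D X₀ with hu
  have hu0 : ∀ p, 0 ≤ u p := fun p => Metric.infDist_nonneg
  have hut : ∀ x t, 0 ≤ t → u (x, t) = Metric.infDist x (reachSet (field f₁ f₂) D X₀ t) :=
    fun x t ht => by simp only [hu, reachDist, max_eq_left ht]
  have hK : 0 < 1 + M := by linarith
  -- Chosen so that `c * exp (-L T) * ρ = 3 δ / 4`: at distance `ρ` the scaled barrier pays for the
  -- shift `δ / 2` and an error `δ / 4`.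
  set c := 3 * δ / 4 * Real.exp (L * T) / ρ with hc
  have hc0 : 0 < c := by positivity
  -- Chosen so that all smoothing errors, scaled by `c`, total less than `δ / 4`; the `+ 1` makes
  -- this strict.
  set η := δ / 4 / (c * (1 + M) * (2 + L * T) + 1) with hη
  have hη0 : 0 < η := by positivity
  have hηδ : c * (1 + M) * (2 + L * T) * η < δ / 4 := by
    have h1 : η * (c * (1 + M) * (2 + L * T) + 1) = δ / 4 := by rw [hη]; field_simp
    linarith
  obtain ⟨w, hwc, hwu, hwL⟩ := exists_contDiff_lieDeriv_le hF hK.le hη0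
    (abs_reachDist_sub_le hF hDne hX₀ne) (A := L * M)
    fun e he x t s ht hs => reachDist_add_le hF hDne hX₀ne he x ht hs
  rw [← hu] at hwu
  have hulip := abs_reachDist_sub_le hF hDne hX₀ne
  rw [← hu] at hulip
  have hshift : ∀ x t, |w (x, t + η) - u (x, t)| ≤ (1 + M) * η + (1 + M) * η := by
    intro x t
    have h1 := hulip (x, t + η) (x, t)
    rw [Prod.mk_sub_mk, sub_self, add_sub_cancel_left, Prod.norm_mk, norm_zero,
      max_eq_right (norm_nonneg _), Real.norm_eq_abs, abs_of_pos hη0] at h1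
    have h2 := abs_sub_le (w (x, t + η)) (u (x, t + η)) (u (x, t))
    linarith [hwu (x, t + η)]
  have hη1 : 0 ≤ (1 + M) * η := by positivity
  -- The time shift by `η` keeps the mollifier within nonnegative times, `exp (-L t)` cancels the
  -- growth rate `L`, and the linear term absorbs the smoothing error `(1 + M) * L * η`.
  refine ⟨fun p => c * (Real.exp (-(L * p.2)) * w (p.1, p.2 + η) - (1 + M) * L * η * p.2) - δ / 2,
    by fun_prop, fun x hx => ?_, fun x hx t ht => ?_, fun x d hd t ht => ?_⟩
  · have h1 : u (x, 0) = 0 := by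
      rw [hut x 0 le_rfl]
      exact Metric.infDist_zero_of_mem (subset_reachSet_zero hF hDne hx)
    have h2 := (le_abs_self _).trans (hshift x 0)
    rw [h1, sub_zero] at h2
    have h3 := mul_le_mul_of_nonneg_left h2 hc0.le
    have h4 : 0 ≤ c * (1 + M) * (L * T) * η := by positivity
    simp only [mul_zero, neg_zero, Real.exp_zero, one_mul, sub_zero]
    linarith
  · have h1 := (neg_le_abs _).trans (hshift x t)
    set E := Real.exp (-(L * t)) with hE
    have hE0 : 0 < E := Real.exp_pos _
    have hE1 : E ≤ 1 := Real.exp_le_one_iff.2 (by have := mul_nonneg hL.le ht.1; linarith)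
    have h2 : E * u (x, t) - 2 * ((1 + M) * η) ≤ E * w (x, t + η) := by
      have h3 := mul_le_mul_of_nonneg_left (show u (x, t) - 2 * ((1 + M) * η) ≤ w (x, t + η) by
        linarith) hE0.le
      have h4 := mul_le_mul_of_nonneg_right hE1 hη1
      linarith
    have h3 : (1 + M) * L * η * t ≤ (1 + M) * L * η * T :=
      mul_le_mul_of_nonneg_left ht.2 (by positivity)
    have h4 : c * (E * u (x, t) - (1 + M) * (2 + L * T) * η)
        ≤ c * (E * w (x, t + η) - (1 + M) * L * η * t) :=
      mul_le_mul_of_nonneg_left (by linarith) hc0.le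
    have h5 : 0 ≤ c * (E * u (x, t)) := mul_nonneg hc0.le (mul_nonneg hE0.le (hu0 _))
    -- If `h x ≤ -3δ/4`, nonnegativity of `u` gives `v > -δ/2 - δ/4`. Otherwise `u ≥ ρ`, so `v ≥
    -- 3δ/4 - δ/4 - δ/2 = 0 ≥ h x`.
    rcases le_or_gt (h x) (-(3 * δ / 4)) with h6 | h6
    · simp only; linarith
    · have h7 := hfar x hx t ht h6
      rw [← hut x t ht.1] at h7
      have h8 : Real.exp (-(L * T)) ≤ E := Real.exp_le_exp.2 (by
        have := mul_le_mul_of_nonneg_left ht.2 hL.le; linarith)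
      have h9 : c * (Real.exp (-(L * T)) * ρ) = 3 * δ / 4 := by
        rw [hc, Real.exp_neg]; field_simp
      have h10 : c * (Real.exp (-(L * T)) * ρ) ≤ c * (E * u (x, t)) :=
        mul_le_mul_of_nonneg_left (mul_le_mul h8 h7 hρ.le hE0.le) hc0.le
      have := hcl x hx
      simp only; linarith
  · set q : EuclideanSpace ℝ (Fin n) × ℝ := (field f₁ f₂ x d, 1) with hq
    have hw := hwL x (t + η) (by linarith) d hd
    rw [← hq] at hw
    have hline : HasDerivAt (fun s : ℝ => (x, t) + s • q) q 0 := by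
      simpa using ((hasDerivAt_id (0 : ℝ)).smul_const q).const_add (x, t)
    have hlineη : HasDerivAt (fun s : ℝ => (x, t + η) + s • q) q 0 := by
      simpa using ((hasDerivAt_id (0 : ℝ)).smul_const q).const_add (x, t + η)
    have hwline : HasDerivAt (fun s : ℝ => w ((x, t + η) + s • q)) (fderiv ℝ w (x, t + η) q) 0 := by
      have h1 : HasFDerivAt w (fderiv ℝ w (x, t + η)) ((x, t + η) + (0 : ℝ) • q) := by
        rw [zero_smul, add_zero]
        exact (hwc.differentiable one_ne_zero _).hasFDerivAt
      exact h1.comp_hasDerivAt 0 hlineη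
    set v : EuclideanSpace ℝ (Fin n) × ℝ → ℝ := fun p =>
      c * (Real.exp (-(L * p.2)) * w (p.1, p.2 + η) - (1 + M) * L * η * p.2) - δ / 2 with hv
    have hvc : ContDiff ℝ 1 v := by rw [hv]; fun_prop
    have hvline : HasDerivAt (fun s : ℝ => v ((x, t) + s • q)) (fderiv ℝ v (x, t) q) 0 := by
      have h1 : HasFDerivAt v (fderiv ℝ v (x, t)) ((x, t) + (0 : ℝ) • q) := by
        rw [zero_smul, add_zero]
        exact (hvc.differentiable one_ne_zero _).hasFDerivAt
      exact h1.comp_hasDerivAt 0 hline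
    have hvline' : HasDerivAt (fun s : ℝ => v ((x, t) + s • q))
        (c * (Real.exp (-(L * t)) * (fderiv ℝ w (x, t + η) q - L * w (x, t + η))
          - (1 + M) * L * η)) 0 := by
      have hexp : HasDerivAt (fun s : ℝ => Real.exp (-(L * (t + s))))
          (Real.exp (-(L * (t + 0))) * -(L * 1)) 0 :=
        ((((hasDerivAt_id (0 : ℝ)).const_add t).const_mul L).neg).exp
      have h1 := (((hexp.mul hwline).sub
        (((hasDerivAt_id (0 : ℝ)).const_add t).const_mul ((1 + M) * L * η))).const_mul c).sub_const
        (δ / 2)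
      refine (h1.congr_of_eventuallyEq (Eventually.of_forall fun s => ?_)).congr_deriv ?_
      · have h2 : ((x, t + η) + s • q) = (x + s • field f₁ f₂ x d, t + s + η) := by
          ext1
          · rfl
          · simp only [hq, Prod.snd_add, Prod.smul_snd, smul_eq_mul]; ring
        simp only [hv, hq, Prod.fst_add, Prod.snd_add, Prod.smul_fst, Prod.smul_snd, smul_eq_mul,
          mul_one, Pi.sub_apply, Pi.mul_apply, id]
        rw [← h2]
      · simp only [zero_smul, add_zero]
        ring
    have hLieeq : lieDeriv (field f₁ f₂) (fderiv ℝ v) x t d = fderiv ℝ v (x, t) q := by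
      rw [lieDeriv, ← map_add, hq]
      simp
    rw [hLieeq, hvline.unique hvline']
    have hE1 : Real.exp (-(L * t)) ≤ 1 :=
      Real.exp_le_one_iff.2 (by have := mul_nonneg hL.le ht; linarith)
    have hKL : 0 ≤ (1 + M) * L * η := by positivity
    have h3 := mul_le_mul_of_nonneg_left
      (show fderiv ℝ w (x, t + η) q - L * w (x, t + η) ≤ (1 + M) * L * η by linarith)
      (Real.exp_pos (-(L * t))).le
    have h4 := mul_le_mul_of_nonneg_right hE1 hKL
    exact mul_nonpos_of_nonneg_of_nonpos hc0.le (by linarith)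

theorem exists_barrier_of_isSafe
    {f₁ : EuclideanSpace ℝ (Fin n) → EuclideanSpace ℝ (Fin n)}
    {f₂ : EuclideanSpace ℝ (Fin n) → (EuclideanSpace ℝ (Fin m) →L[ℝ] EuclideanSpace ℝ (Fin n))}
    (hf : LipschitzOnCompactsUniformly (field f₁ f₂) D)
    (hD : IsCompact D) (hDconv : Convex ℝ D) (hDne : D.Nonempty) (hX₀ : IsCompact X₀)
    (hh : Continuous h) (hSbdd : Bornology.IsBounded S) (hS : S = {x | h x < 0}) (hT : 0 ≤ T)
    (hsafe : IsSafe (field f₁ f₂) D X₀ S T) :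
    ∃ v : EuclideanSpace ℝ (Fin n) × ℝ → ℝ, ContDiff ℝ 1 v ∧ (∀ x ∈ X₀, v (x, 0) < 0) ∧
      (∀ x ∈ closure S, ∀ t ∈ Icc 0 T, h x ≤ v (x, t)) ∧
      ∀ x ∈ closure S, ∀ d ∈ D, ∀ t ∈ Icc 0 T,
        lieDeriv (field f₁ f₂) (fderiv ℝ v) x t d ≤ 0 := by
  -- Without initial states there are no reachable ones, and the distance to them is meaningless;
  -- since `h ≤ 0` on `closure S`, the zero function serves.
  rcases X₀.eq_empty_or_nonempty with rfl | hX₀ne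
  · refine ⟨fun _ => 0, contDiff_const, fun x hx => absurd hx (notMem_empty x), fun x hx t _ =>
      nonpos_of_mem_closure hh hS hx, fun x _ d _ t _ => by simp [lieDeriv]⟩
  obtain ⟨r, hr⟩ := hSbdd.closure.exists_norm_le
  obtain ⟨g₁, g₂, L, M, hF, hgf⟩ := exists_boundedLipschitz_truncation f₁ f₂ hD hf r
  obtain ⟨v, hv, hv0, hvh, hvL⟩ := exists_barrier_of_reachSet_subset hF hD hDconv hDne hX₀ hX₀ne hh
    hSbdd hS hT fun t ht =>
      hsafe.reachSet_subset hF (fun y hy => (hgf y (hr y (subset_closure hy))).symm) ht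
  refine ⟨v, hv, hv0, hvh, fun x hx d hd t ht => ?_⟩
  have := hvL x d hd t ht.1
  rwa [lieDeriv, hgf x (hr x hx)] at this

theorem isSafe_zero_field (hX₀S : X₀ ⊆ S) :
    IsSafe (field (fun _ => 0) (fun _ => 0)) D X₀ S T := by
  have hzero : field (n := n) (m := m) (fun _ => 0) (fun _ => 0) = fun _ _ => 0 := by
    funext x d; simp [field]
  rw [hzero]
  refine fun x₀ hx₀ d _ => ⟨⟨fun _ => x₀, continuousOn_const, intervalIntegrable_const,
    fun t _ => by simp⟩, fun x hx t ht => ?_⟩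
  rw [hx.eq_integral t ht]
  simpa using hX₀S hx₀

end FiniteTimeSafety

theorem mainTheorem2 (n m : ℕ)
    (f₁ : EuclideanSpace ℝ (Fin n) → EuclideanSpace ℝ (Fin n))
    (f₂ : EuclideanSpace ℝ (Fin n) → (EuclideanSpace ℝ (Fin m) →L[ℝ] EuclideanSpace ℝ (Fin n)))
    (D : Set (EuclideanSpace ℝ (Fin m))) (hD : IsCompact D) (hDconv : Convex ℝ D)
    (hf : FiniteTimeSafety.LipschitzOnCompactsUniformly (FiniteTimeSafety.field f₁ f₂) D)
    (h : EuclideanSpace ℝ (Fin n) → ℝ) (hh : LocallyLipschitz h)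
    (S : Set (EuclideanSpace ℝ (Fin n))) (hSopen : IsOpen S) (hSbdd : Bornology.IsBounded S)
    (hS : S = {x | h x < 0}) (hSfrontier : frontier S = {x | h x = 0})
    (X₀ : Set (EuclideanSpace ℝ (Fin n))) (hX₀ : IsCompact X₀) (hX₀S : X₀ ⊆ S)
    (T : ℝ) (hT : 0 ≤ T) :
    FiniteTimeSafety.IsSafe (FiniteTimeSafety.field f₁ f₂) D X₀ S T ↔
      ∃ (v : EuclideanSpace ℝ (Fin n) × ℝ → ℝ)
        (v' : EuclideanSpace ℝ (Fin n) × ℝ → (EuclideanSpace ℝ (Fin n) × ℝ →L[ℝ] ℝ)),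
        FiniteTimeSafety.HasContDerivOn v v' (closure S ×ˢ Icc 0 T) ∧
        (∀ x ∈ X₀, v (x, 0) < 0) ∧
        (∀ x ∈ closure S, ∀ t ∈ Icc 0 T, h x - v (x, t) ≤ 0) ∧
        (∀ x ∈ closure S, ∀ d ∈ D, ∀ t ∈ Icc 0 T,
          FiniteTimeSafety.lieDeriv (FiniteTimeSafety.field f₁ f₂) v' x t d ≤ 0) := by
  open FiniteTimeSafety in
  constructor
  · intro hsafe
    suffices hex : ∃ v : EuclideanSpace ℝ (Fin n) × ℝ → ℝ, ContDiff ℝ 1 v ∧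
        (∀ x ∈ X₀, v (x, 0) < 0) ∧ (∀ x ∈ closure S, ∀ t ∈ Icc 0 T, h x ≤ v (x, t)) ∧
        ∀ x ∈ closure S, ∀ d ∈ D, ∀ t ∈ Icc 0 T,
          lieDeriv (field f₁ f₂) (fderiv ℝ v) x t d ≤ 0 by
      obtain ⟨v, hv, hv0, hvh, hvL⟩ := hex
      exact ⟨v, fderiv ℝ v, ⟨fun p _ =>
        (hv.differentiable one_ne_zero p).hasFDerivAt.hasFDerivWithinAt,
        (hv.continuous_fderiv one_ne_zero).continuousOn⟩, hv0,
        fun x hx t ht => sub_nonpos.2 (hvh x hx t ht), hvL⟩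
    -- If `D` is empty there are no disturbances and condition 3 is vacuous. A function satisfying
    -- conditions 1 and 2 comes from the stationary system with `D = {0}`, which is safe because `X₀
    -- ⊆ S`.
    rcases D.eq_empty_or_nonempty with rfl | hDne
    · obtain ⟨v, hv, hv0, hvh, -⟩ := exists_barrier_of_isSafe (m := m) (D := {0})
        (f₁ := fun _ => 0) (f₂ := fun _ => 0) (X₀ := X₀)
        (fun X _ => ⟨0, fun x _ y _ d _ => by simp [field]⟩) isCompact_singleton
        (convex_singleton _) (singleton_nonempty _) hX₀ hh.continuous hSbdd hS hT
        (isSafe_zero_field hX₀S)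
      exact ⟨v, hv, hv0, hvh, fun x _ d hd => absurd hd (notMem_empty d)⟩
    · exact exists_barrier_of_isSafe hf hD hDconv hDne hX₀ hh.continuous hSbdd hS hT hsafe
  · rintro ⟨v, v', hv, hv0, hvh, hvL⟩
    obtain ⟨r, hr⟩ := hSbdd.closure.exists_norm_le
    obtain ⟨g₁, g₂, L, M, hF, hgf⟩ := exists_boundedLipschitz_truncation f₁ f₂ hD hf r
    exact isSafe_of_barrier hF (fun y hy => (hgf y (hr y hy)).symm) hSopen hS hX₀S hT
      hv.hasFDerivWithinAt hv0 hvh hvL
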